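/- **Theorem (PBW theorem for Leibniz algebras, Bokut–Chen–Liu).** *Conventions.* Let $k$ be a field. A *dialgebra* over $k$ is a $k$-space with two bilinear associative products $\dashv,\vdash$ such that $a\dashv(b\vdash c)=(a\dashv b)\dashv c$, $(a\dashv b)\vdash c=a\vdash(b\vdash c)$ and $a\vdash(b\dashv c)=(a\vdash b)\dashv c$. The free dialgebra $D(X)$ has as linear basis the set $[X^*]$ of normal diwords $[u]=x_{-m}\vdash\cdots\vdash x_0\dashv\cdots\dashv x_n=x_{-m}\cdots\dot x_0\cdots x_n$ ($x_i\in X$, $m,n\ge 0$, $x_0$ is the center). If $X$ is linearly ordered, diwords are ordered by comparing the weights $(n+m+1,\,m,\,x_{-m},\dots,x_n)$ lexicographically; $|u|=n+m+1$ is the degree, $\bar f$ denotes the leading diword of $f\neq 0$, and $f$ is monic if its leading coefficient is $1$. $Id(S)$ is the ideal generated by $S$, and $D(X|S)=D(X)/Id(S)$. A polynomial is *left normed* (*right normed*) if in each of its diwords the center is the last (first) letter. For $s\in D(X)$, an *$s$-diword* $[asb]$ is obtained from a normal diword $x_{-m}\vdash\cdots\vdash x_0\dashv\cdots\dashv x_n$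 by substituting $s$ for one letter $x_l$; it is *normal* if $l=0$, or $l<0$ and $s$ is left normed, or $l>0$ and $s$ is right normed; $[a\bar sb]$ is the diword obtained by substituting $\bar s$. A normal $s$-diword $[asb]$ is a left (right) normed $s$-diword if both $s$ and $[asb]$ are left (right) normed. Let $S\subset D(X)$ be a set of monic polynomials. For $f,g\in S$ the *compositions* are: (1) $x\dashv f$ ($x\in X$) if $f$ is not right normed, and $f\vdash x$ ($x\in X$) if $f$ is not left normed; (2) $f-[agb]$ if $[w]=\bar f=[a\bar gb]$ with $[agb]$ normal; (3) $[fb]-[ag]$ if $[w]=[\bar fb]=[a\bar g]$, $|\bar f|+|\bar g|>|w|$, with $[fb]$ and $[ag]$ normal. A composition $h=x\dashv f$ (respectively $h=f\vdash x$) is *trivial* if it is a linear combination of right (respectively left) normed $s$-diwords $[asb]$, $s\in S$, with $|[a\bar sb]|\le\deg h$. A composition of type (2) or (3) is *trivial* if it is a linear combination of normal $s$-diwords $[asb]$, $s\in S$, with $[a\bar sb]<[w]$, which moreover can be taken to be left (right) normed $s$-diwords if both $f$ and $[agb]$, respectively both $[fb]$ and $[ag]$, are left (right) normed $f$- or $g$-diwords.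 $S$ is a *Gröbner–Shirshov basis* in $D(X)$ if it consists of monic polynomials and all compositions of its elements are trivial. *Statement.* Let $\mathcal L$ be a Leibniz algebra over $k$, i.e. a $k$-space with a bilinear product $\{\,,\}$ satisfying $\{\{x,y\},z\}=\{\{x,z\},y\}+\{x,\{y,z\}\}$. Let $\mathcal L_0$ be the subspace spanned by all $\{a,a\}$ and $\{a,b\}+\{b,a\}$, $a,b\in\mathcal L$. Let $X=\{x_i\mid i\in I\}$ be a linearly ordered basis of $\mathcal L$ (with $i<j\iff x_i<x_j$) and $I_0\subseteq I$ such that $\{x_i\mid i\in I_0\}$ is a basis of $\mathcal L_0$. Identify $\mathcal L$ with the span of $X$ in $D(X)$. Let the universal enveloping dialgebra be $U(\mathcal L)=D(X\mid x_i\dashv x_j-x_j\vdash x_i=\{x_i,x_j\},\ i,j\in I)$. Let $S\subset D(X)$ consist of 1. $x_j\vdash x_i-x_i\dashv x_j+\{x_i,x_j\}$ ($i,j\in I$); 2. $x_j\vdash x_i\vdash x_t-x_i\vdash x_j\vdash x_t+\{x_i,x_j\}\vdash x_t$ ($i,j,t\in I$, $j>i$); 3. $x_{i_0}\vdash x_t$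 ($i_0\in I_0$, $t\in I$); 4. $x_t\dashv x_j\dashv x_i-x_t\dashv x_i\dashv x_j+x_t\dashv\{x_i,x_j\}$ ($i,j,t\in I$, $j>i$); 5. $x_t\dashv x_{i_0}$ ($i_0\in I_0$, $t\in I$). Then: (i) $S$ is a Gröbner–Shirshov basis in $D(X)$. (ii) $U(\mathcal L)=D(X|S)$, i.e. $S$ and the defining relations of $U(\mathcal L)$ generate the same ideal; and the elements $x_j\dashv x_{i_1}\dashv\cdots\dashv x_{i_n}$ with $n\ge 0$, $j\in I$, $i_1,\dots,i_n\in I\setminus I_0$, $i_1\le\cdots\le i_n$ (indexed by the tuples $(j,i_1,\dots,i_n)$) form a linear basis of $U(\mathcal L)$. In particular, the canonical linear map $\iota:\mathcal L\to U(\mathcal L)$, $x_i\mapsto x_i$, is injective, and it satisfies $\iota(\{a,b\})=\iota(a)\dashv\iota(b)-\iota(b)\vdash\iota(a)$, so that $\mathcal L$ embeds into $U(\mathcal L)$. -/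

import Mathlib

/-- The two multiplications of a dialgebra. -/
class DiMul (D : Type*) where
  dashv : D → D → D
  vdash : D → D → D

infixl:70 " ⊣ᵈ " => DiMul.dashv
infixl:70 " ⊢ᵈ " => DiMul.vdash

/-- A dialgebra over `k`: a `k`-module with two bilinear associative multiplications satisfying
the three mixed identities `a ⊣ (b ⊢ c) = (a ⊣ b) ⊣ c`, `(a ⊣ b) ⊢ c = a ⊢ (b ⊢ c)` and
`a ⊢ (b ⊣ c) = (a ⊢ b) ⊣ c`. -/
class Dialgebra (k D : Type*) [CommRing k] [AddCommGroup D] [Module k D] extends DiMul D where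
  add_dashv : ∀ a b c : D, (a + b) ⊣ᵈ c = a ⊣ᵈ c + b ⊣ᵈ c
  dashv_add : ∀ a b c : D, a ⊣ᵈ (b + c) = a ⊣ᵈ b + a ⊣ᵈ c
  smul_dashv : ∀ (r : k) (a b : D), (r • a) ⊣ᵈ b = r • (a ⊣ᵈ b)
  dashv_smul : ∀ (r : k) (a b : D), a ⊣ᵈ (r • b) = r • (a ⊣ᵈ b)
  add_vdash : ∀ a b c : D, (a + b) ⊢ᵈ c = a ⊢ᵈ c + b ⊢ᵈ c
  vdash_add : ∀ a b c : D, a ⊢ᵈ (b + c) = a ⊢ᵈ b + a ⊢ᵈ c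
  smul_vdash : ∀ (r : k) (a b : D), (r • a) ⊢ᵈ b = r • (a ⊢ᵈ b)
  vdash_smul : ∀ (r : k) (a b : D), a ⊢ᵈ (r • b) = r • (a ⊢ᵈ b)
  dashv_assoc : ∀ a b c : D, (a ⊣ᵈ b) ⊣ᵈ c = a ⊣ᵈ (b ⊣ᵈ c)
  vdash_assoc : ∀ a b c : D, (a ⊢ᵈ b) ⊢ᵈ c = a ⊢ᵈ (b ⊢ᵈ c)
  dashv_vdash : ∀ a b c : D, a ⊣ᵈ (b ⊢ᵈ c) = (a ⊣ᵈ b) ⊣ᵈ c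
  dashv_vdash' : ∀ a b c : D, (a ⊣ᵈ b) ⊢ᵈ c = a ⊢ᵈ (b ⊢ᵈ c)
  vdash_dashv : ∀ a b c : D, a ⊢ᵈ (b ⊣ᵈ c) = (a ⊢ᵈ b) ⊣ᵈ c

/-! ### Ideals and quotients of dialgebras -/

section Ideals

variable {k D : Type*} [CommRing k] [AddCommGroup D] [Module k D]

/-- A (two-sided) ideal of a dialgebra, as a property of a submodule. -/
class IsDiIdeal [DiMul D] (J : Submodule k D) : Prop where
  dashv_left : ∀ (a : D) {b : D}, b ∈ J → a ⊣ᵈ b ∈ J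
  dashv_right : ∀ {a : D} (b : D), a ∈ J → a ⊣ᵈ b ∈ J
  vdash_left : ∀ (a : D) {b : D}, b ∈ J → a ⊢ᵈ b ∈ J
  vdash_right : ∀ {a : D} (b : D), a ∈ J → a ⊢ᵈ b ∈ J

variable (k) in
/-- `Id(S)`: the ideal generated by `S`. -/
def diIdeal [DiMul D] (S : Set D) : Submodule k D :=
  sInf {J : Submodule k D | S ⊆ J ∧ IsDiIdeal J}

instance [DiMul D] (S : Set D) : IsDiIdeal (diIdeal k S) where
  dashv_left a b hb := by
    simp only [diIdeal, Submodule.mem_sInf] at hb ⊢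
    exact fun J hJ => hJ.2.dashv_left a (hb J hJ)
  dashv_right {a} b ha := by
    simp only [diIdeal, Submodule.mem_sInf] at ha ⊢
    exact fun J hJ => hJ.2.dashv_right b (ha J hJ)
  vdash_left a b hb := by
    simp only [diIdeal, Submodule.mem_sInf] at hb ⊢
    exact fun J hJ => hJ.2.vdash_left a (hb J hJ)
  vdash_right {a} b ha := by
    simp only [diIdeal, Submodule.mem_sInf] at ha ⊢
    exact fun J hJ => hJ.2.vdash_right b (ha J hJ)

/-- The quotient of a dialgebra by an ideal, with the induced multiplications
`[a] ⊣ [b] = [a ⊣ b]` and `[a] ⊢ [b] = [a ⊢ b]`. -/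
instance [Dialgebra k D] (J : Submodule k D) [IsDiIdeal J] : Dialgebra k (D ⧸ J) where
  dashv := Quotient.map₂ (· ⊣ᵈ ·) (by
    intro a a' ha b b' hb
    rw [← Quotient.eq_iff_equiv] at ha hb ⊢
    have ha' := (Submodule.Quotient.eq J).1 ha
    have hb' := (Submodule.Quotient.eq J).1 hb
    refine (Submodule.Quotient.eq J).2 ?_
    have h := J.add_mem (IsDiIdeal.dashv_right (J := J) b ha')
      (IsDiIdeal.dashv_left (J := J) a' hb')
    have e1 : a ⊣ᵈ b = (a - a') ⊣ᵈ b + a' ⊣ᵈ b := by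
      rw [← Dialgebra.add_dashv (k := k), sub_add_cancel]
    have e2 : a' ⊣ᵈ b = a' ⊣ᵈ (b - b') + a' ⊣ᵈ b' := by
      rw [← Dialgebra.dashv_add (k := k), sub_add_cancel]
    have e : a ⊣ᵈ b - a' ⊣ᵈ b' = (a - a') ⊣ᵈ b + a' ⊣ᵈ (b - b') := by
      rw [e1, e2]; abel
    simpa only [e] using h)
  vdash := Quotient.map₂ (· ⊢ᵈ ·) (by
    intro a a' ha b b' hb
    rw [← Quotient.eq_iff_equiv] at ha hb ⊢
    have ha' := (Submodule.Quotient.eq J).1 ha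
    have hb' := (Submodule.Quotient.eq J).1 hb
    refine (Submodule.Quotient.eq J).2 ?_
    have h := J.add_mem (IsDiIdeal.vdash_right (J := J) b ha')
      (IsDiIdeal.vdash_left (J := J) a' hb')
    have e1 : a ⊢ᵈ b = (a - a') ⊢ᵈ b + a' ⊢ᵈ b := by
      rw [← Dialgebra.add_vdash (k := k), sub_add_cancel]
    have e2 : a' ⊢ᵈ b = a' ⊢ᵈ (b - b') + a' ⊢ᵈ b' := by
      rw [← Dialgebra.vdash_add (k := k), sub_add_cancel]
    have e : a ⊢ᵈ b - a' ⊢ᵈ b' = (a - a') ⊢ᵈ b + a' ⊢ᵈ (b - b') := by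
      rw [e1, e2]; abel
    simpa only [e] using h)
  add_dashv := by
    rintro ⟨a⟩ ⟨b⟩ ⟨c⟩
    exact congrArg (Submodule.Quotient.mk (p := J)) (Dialgebra.add_dashv (k := k) a b c)
  dashv_add := by
    rintro ⟨a⟩ ⟨b⟩ ⟨c⟩
    exact congrArg (Submodule.Quotient.mk (p := J)) (Dialgebra.dashv_add (k := k) a b c)
  smul_dashv := by
    rintro r ⟨a⟩ ⟨b⟩
    exact congrArg (Submodule.Quotient.mk (p := J)) (Dialgebra.smul_dashv r a b)
  dashv_smul := by
    rintro r ⟨a⟩ ⟨b⟩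
    exact congrArg (Submodule.Quotient.mk (p := J)) (Dialgebra.dashv_smul r a b)
  add_vdash := by
    rintro ⟨a⟩ ⟨b⟩ ⟨c⟩
    exact congrArg (Submodule.Quotient.mk (p := J)) (Dialgebra.add_vdash (k := k) a b c)
  vdash_add := by
    rintro ⟨a⟩ ⟨b⟩ ⟨c⟩
    exact congrArg (Submodule.Quotient.mk (p := J)) (Dialgebra.vdash_add (k := k) a b c)
  smul_vdash := by
    rintro r ⟨a⟩ ⟨b⟩
    exact congrArg (Submodule.Quotient.mk (p := J)) (Dialgebra.smul_vdash r a b)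
  vdash_smul := by
    rintro r ⟨a⟩ ⟨b⟩
    exact congrArg (Submodule.Quotient.mk (p := J)) (Dialgebra.vdash_smul r a b)
  dashv_assoc := by
    rintro ⟨a⟩ ⟨b⟩ ⟨c⟩
    exact congrArg (Submodule.Quotient.mk (p := J)) (Dialgebra.dashv_assoc (k := k) a b c)
  vdash_assoc := by
    rintro ⟨a⟩ ⟨b⟩ ⟨c⟩
    exact congrArg (Submodule.Quotient.mk (p := J)) (Dialgebra.vdash_assoc (k := k) a b c)
  dashv_vdash := by
    rintro ⟨a⟩ ⟨b⟩ ⟨c⟩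
    exact congrArg (Submodule.Quotient.mk (p := J)) (Dialgebra.dashv_vdash (k := k) a b c)
  dashv_vdash' := by
    rintro ⟨a⟩ ⟨b⟩ ⟨c⟩
    exact congrArg (Submodule.Quotient.mk (p := J)) (Dialgebra.dashv_vdash' (k := k) a b c)
  vdash_dashv := by
    rintro ⟨a⟩ ⟨b⟩ ⟨c⟩
    exact congrArg (Submodule.Quotient.mk (p := J)) (Dialgebra.vdash_dashv (k := k) a b c)

end Ideals

/-! ### Normal diwords and the free dialgebra -/

/-- The normal diword `x₋ₘ ⊢ ⋯ ⊢ x₋₁ ⊢ x₀ ⊣ x₁ ⊣ ⋯ ⊣ xₙ`, with `pre = [x₋ₘ, …, x₋₁]`,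
`center = x₀` and `post = [x₁, …, xₙ]`. -/
@[ext]
structure Diword (X : Type*) where
  pre : List X
  center : X
  post : List X

namespace Diword

variable {X : Type*}

/-- The underlying associative word. -/
def letters (u : Diword X) : List X := u.pre ++ u.center :: u.post

/-- The degree of a diword. -/
def length (u : Diword X) : ℕ := u.letters.length

/-- `[u] ⊣ [v]`: concatenation with the center of `u`. -/
def dashv (u v : Diword X) : Diword X := ⟨u.pre, u.center, u.post ++ v.letters⟩

/-- `[u] ⊢ [v]`: concatenation with the center of `v`. -/
def vdash (u v : Diword X) : Diword X := ⟨u.letters ++ v.pre, v.center, v.post⟩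

/-- The weight `(n + m + 1, m, x₋ₘ, …, xₙ)`, in a lexicographic product. -/
def weight (u : Diword X) : ℕ ×ₗ (ℕ ×ₗ List X) :=
  toLex (u.length, toLex (u.pre.length, u.letters))

theorem weight_injective : Function.Injective (weight (X := X)) := by
  intro u v h
  have h1 := congrArg (fun p => (ofLex (ofLex p).2).1) h
  have h2 := congrArg (fun p => (ofLex (ofLex p).2).2) h
  change u.pre.length = v.pre.length at h1
  change u.pre ++ u.center :: u.post = v.pre ++ v.center :: v.post at h2
  obtain ⟨h3, h4⟩ := List.append_inj h2 h1
  rw [List.cons.injEq] at h4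
  exact Diword.ext h3 h4.1 h4.2

/-- The deg-lex order on diwords: comparison of weights. -/
noncomputable instance [LinearOrder X] : LinearOrder (Diword X) :=
  LinearOrder.lift' weight weight_injective

end Diword

/-- The free dialgebra `D(X)` over `k`, with the normal diwords as a linear basis. -/
abbrev FreeDialgebra (k X : Type*) [CommRing k] := Diword X →₀ k

namespace FreeDialgebra

variable {k X : Type*} [CommRing k]

/-- The bilinear extension of a binary operation on diwords. -/
noncomputable def bilin (op : Diword X → Diword X → Diword X) :
    FreeDialgebra k X →ₗ[k] FreeDialgebra k X →ₗ[k] FreeDialgebra k X :=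
  Finsupp.linearCombination k fun u => Finsupp.lmapDomain k k (op u)

theorem bilin_single (op : Diword X → Diword X → Diword X) (u v : Diword X) (r s : k) :
    bilin op (Finsupp.single u r) (Finsupp.single v s) = Finsupp.single (op u v) (r * s) := by
  simp [bilin]

theorem bilin_assoc (p q p' q' : Diword X → Diword X → Diword X)
    (h : ∀ u v w, p (q u v) w = p' u (q' v w)) (a b c : FreeDialgebra k X) :
    bilin p (bilin q a b) c = bilin p' a (bilin q' b c) := by
  induction a using Finsupp.induction_linear with
  | zero => simp
  | add a₁ a₂ h₁ h₂ => simp only [map_add, LinearMap.add_apply, h₁, h₂]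
  | single u r =>
    induction b using Finsupp.induction_linear with
    | zero => simp
    | add b₁ b₂ h₁ h₂ => simp only [map_add, LinearMap.add_apply, h₁, h₂]
    | single v s =>
      induction c using Finsupp.induction_linear with
      | zero => simp
      | add c₁ c₂ h₁ h₂ => simp only [map_add, h₁, h₂]
      | single w t => simp only [bilin_single, h, mul_assoc]

noncomputable instance : Dialgebra k (FreeDialgebra k X) where
  dashv a b := bilin Diword.dashv a b
  vdash a b := bilin Diword.vdash a b
  add_dashv := by simp
  dashv_add := by simp
  smul_dashv := by simp
  dashv_smul := by simp
  add_vdash := by simp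
  vdash_add := by simp
  smul_vdash := by simp
  vdash_smul := by simp
  dashv_assoc := bilin_assoc _ _ _ _ (by simp [Diword.dashv, Diword.letters])
  vdash_assoc := bilin_assoc _ _ _ _ (by simp [Diword.vdash, Diword.letters])
  dashv_vdash a b c := (bilin_assoc _ _ _ _
    (by simp [Diword.dashv, Diword.vdash, Diword.letters]) a b c).symm
  dashv_vdash' := bilin_assoc _ _ _ _ (by simp [Diword.dashv, Diword.vdash, Diword.letters])
  vdash_dashv a b c := (bilin_assoc _ _ _ _
    (by simp [Diword.dashv, Diword.vdash, Diword.letters]) a b c).symm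

variable (k) in
/-- The generator of `D(X)` given by a letter. -/
noncomputable def of (x : X) : FreeDialgebra k X := Finsupp.single ⟨[], x, []⟩ 1

variable (k) in
/-- A diword as an element of `D(X)`. -/
noncomputable def ofWord (u : Diword X) : FreeDialgebra k X := Finsupp.single u 1

/-- `x₁ ⊢ (x₂ ⊢ ⋯ ⊢ (xₙ ⊢ f))`. -/
noncomputable def wordVdash (a : List X) (f : FreeDialgebra k X) : FreeDialgebra k X :=
  a.foldr (fun x g => of k x ⊢ᵈ g) f

/-- `((f ⊣ x₁) ⊣ x₂) ⊣ ⋯ ⊣ xₙ`. -/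
noncomputable def dashvWord (f : FreeDialgebra k X) (b : List X) : FreeDialgebra k X :=
  b.foldl (fun g x => g ⊣ᵈ of k x) f

/-- All diwords of `f` have their last letter as center: `f = ∑ αᵢ uᵢ ẋᵢ`. -/
def IsLeftNormed (f : FreeDialgebra k X) : Prop := ∀ u ∈ f.support, u.post = []

/-- All diwords of `f` have their first letter as center: `f = ∑ αᵢ ẋᵢ uᵢ`. -/
def IsRightNormed (f : FreeDialgebra k X) : Prop := ∀ u ∈ f.support, u.pre = []

/-- The degree of a polynomial (`0` for the zero polynomial). -/
def degree (f : FreeDialgebra k X) : ℕ := f.support.sup Diword.length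

/-- `u` is the leading diword of `f`. -/
def IsLeading [LinearOrder X] (f : FreeDialgebra k X) (u : Diword X) : Prop :=
  IsGreatest (f.support : Set (Diword X)) u

/-- `f` is nonzero with leading coefficient `1`. -/
def IsMonic [LinearOrder X] (f : FreeDialgebra k X) : Prop := ∃ u, IsLeading f u ∧ f u = 1

end FreeDialgebra

/-! ### Gröbner–Shirshov bases in the free dialgebra -/

/-- A diword with one letter replaced by a hole, sorted by the position of the hole
relative to the center. -/
inductive DiContext (X : Type*)
  /-- `a ⊢ □ ⊣ b`: the hole is the center. -/
  | center (a b : List X)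
  /-- `a ⊢ □ ⊢ d`: the hole stands before the center, which is that of the diword `d`. -/
  | before (a : List X) (d : Diword X)
  /-- `d ⊣ □ ⊣ b`: the hole stands after the center, which is that of the diword `d`. -/
  | after (d : Diword X) (b : List X)

namespace DiContext

open FreeDialgebra

variable {k X : Type*} [CommRing k]

/-- The `s`-diword `[asb]`. -/
noncomputable def plug (s : FreeDialgebra k X) : DiContext X → FreeDialgebra k X
  | center a b => dashvWord (wordVdash a s) b
  | before a d => wordVdash a (s ⊢ᵈ ofWord k d)
  | after d b => dashvWord (ofWord k d ⊣ᵈ s) b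

/-- The diword `[a[u]b]`. -/
def plugWord (u : Diword X) : DiContext X → Diword X
  | center a b => ⟨a ++ u.pre, u.center, u.post ++ b⟩
  | before a d => ⟨a ++ u.letters ++ d.pre, d.center, d.post⟩
  | after d b => ⟨d.pre, d.center, d.post ++ u.letters ++ b⟩

/-- The `s`-diword `[asb]` is normal. -/
def IsNormal (s : FreeDialgebra k X) : DiContext X → Prop
  | center _ _ => True
  | before _ _ => IsLeftNormed s
  | after _ _ => IsRightNormed s

/-- Nothing stands to the left of the hole: `[sb]`. -/
def NoLeft : DiContext X → Prop
  | center a _ => a = []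
  | before a _ => a = []
  | after _ _ => False

/-- Nothing stands to the right of the hole: `[as]`. -/
def NoRight : DiContext X → Prop
  | center _ b => b = []
  | before _ _ => False
  | after _ b => b = []

end DiContext

namespace FreeDialgebra

variable {k X : Type*} [CommRing k] [LinearOrder X]

/-- The linear combinations of normal `S`-diwords `[asb]`, `s ∈ S`, such that the diword
`[a[s̄]b]` satisfies `P` and such that both `s` and `[asb]` satisfy `N`. -/
noncomputable def normalSpan (S : Set (FreeDialgebra k X)) (P : Diword X → Prop)
    (N : FreeDialgebra k X → Prop) : Submodule k (FreeDialgebra k X) :=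
  Submodule.span k {g | ∃ s ∈ S, ∃ u, IsLeading s u ∧ ∃ c : DiContext X,
    c.IsNormal s ∧ P (c.plugWord u) ∧ N s ∧ N (c.plug s) ∧ g = c.plug s}

/-- Triviality modulo `(S, [w])` of the composition `p - q` with ambiguity `[w]`, where
`p = [a₁ f b₁]` and `q = [a₂ g b₂]` are normal `S`-diwords with leading diword `[w]`.
If `p` and `q` are both left (right) normed `S`-diwords, that is, `f`, `p`, `g`, `q` are all left
(right) normed, then only left (right) normed `S`-diwords may be used. -/
def IsTrivialComposition (S : Set (FreeDialgebra k X)) (w : Diword X)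
    (f p g q : FreeDialgebra k X) : Prop :=
  p - q ∈ normalSpan S (· < w) (fun _ => True) ∧
  (IsLeftNormed f ∧ IsLeftNormed p ∧ IsLeftNormed g ∧ IsLeftNormed q →
    p - q ∈ normalSpan S (· < w) IsLeftNormed) ∧
  (IsRightNormed f ∧ IsRightNormed p ∧ IsRightNormed g ∧ IsRightNormed q →
    p - q ∈ normalSpan S (· < w) IsRightNormed)

/-- `S` is a Gröbner–Shirshov basis in `D(X)`: it is a set of monic polynomials all of whose
compositions are trivial. -/
structure IsGroebnerShirshovBasis (S : Set (FreeDialgebra k X)) : Prop where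
  monic : ∀ f ∈ S, IsMonic f
  /-- compositions of left multiplication -/
  left_mul : ∀ f ∈ S, ¬ IsRightNormed f → ∀ x : X,
    of k x ⊣ᵈ f ∈ normalSpan S (fun v => v.length ≤ degree (of k x ⊣ᵈ f)) IsRightNormed
  /-- compositions of right multiplication -/
  right_mul : ∀ f ∈ S, ¬ IsLeftNormed f → ∀ x : X,
    f ⊢ᵈ of k x ∈ normalSpan S (fun v => v.length ≤ degree (f ⊢ᵈ of k x)) IsLeftNormed
  /-- compositions of inclusion: `[w] = [f̄] = [a[ḡ]b]` -/
  inclusion : ∀ f ∈ S, ∀ g ∈ S, ∀ u v, IsLeading f u → IsLeading g v →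
    ∀ c : DiContext X, c.IsNormal g → u = c.plugWord v →
      IsTrivialComposition S u f f g (c.plug g)
  /-- compositions of intersection: `[w] = [[f̄]b] = [a[ḡ]]` with `|f̄| + |ḡ| > |w|` -/
  intersection : ∀ f ∈ S, ∀ g ∈ S, ∀ u v, IsLeading f u → IsLeading g v →
    ∀ c d : DiContext X, c.NoLeft → d.NoRight → c.IsNormal f → d.IsNormal g →
      c.plugWord u = d.plugWord v → (c.plugWord u).length < u.length + v.length →
      IsTrivialComposition S (c.plugWord u) f (c.plug f) g (d.plug g)

end FreeDialgebra

/-! ### Leibniz algebras and their universal enveloping dialgebras -/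

section Leibniz

open FreeDialgebra

variable {k L I : Type*} [CommRing k] [AddCommGroup L] [Module k L]

/-- The (right) Leibniz identity `{{x,y},z} = {{x,z},y} + {x,{y,z}}` for a bilinear product. -/
def IsLeibniz (br : L →ₗ[k] L →ₗ[k] L) : Prop :=
  ∀ x y z : L, br (br x y) z = br (br x z) y + br x (br y z)

/-- The subspace `L₀` spanned by all `{a,a}` and `{a,b} + {b,a}`. -/
def leibnizKernel (br : L →ₗ[k] L →ₗ[k] L) : Submodule k L :=
  Submodule.span k ({c | ∃ a, c = br a a} ∪ {c | ∃ a b, c = br a b + br b a})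

/-- The linear map `L → D(X)` sending the basis vector `xᵢ` to the generator `xᵢ`; letters are
represented by their indices. -/
noncomputable def linearForm (x : Module.Basis I k L) : L →ₗ[k] FreeDialgebra k I :=
  x.constr k (of k)

/-- The defining relations `xᵢ ⊣ xⱼ - xⱼ ⊢ xᵢ = {xᵢ,xⱼ}` of the universal enveloping dialgebra. -/
def envelopingRelations (br : L →ₗ[k] L →ₗ[k] L) (x : Module.Basis I k L) :
    Set (FreeDialgebra k I) :=
  {f | ∃ i j, f = of k i ⊣ᵈ of k j - of k j ⊢ᵈ of k i - linearForm x (br (x i) (x j))}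

/-- The universal enveloping dialgebra `U(L)`. -/
abbrev EnvelopingDialgebra (br : L →ₗ[k] L →ₗ[k] L) (x : Module.Basis I k L) :=
  FreeDialgebra k I ⧸ diIdeal k (envelopingRelations br x)

/-- The canonical map `L → U(L)`, `xᵢ ↦ xᵢ`. -/
noncomputable def toEnveloping (br : L →ₗ[k] L →ₗ[k] L) (x : Module.Basis I k L) :
    L →ₗ[k] EnvelopingDialgebra br x :=
  (diIdeal k (envelopingRelations br x)).mkQ ∘ₗ linearForm x

/-- The set `S`, the union of its five families. -/
def pbwSet [LinearOrder I] (br : L →ₗ[k] L →ₗ[k] L) (x : Module.Basis I k L) (I₀ : Set I) :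
    Set (FreeDialgebra k I) :=
  {f | ∃ i j, f = of k j ⊢ᵈ of k i - of k i ⊣ᵈ of k j + linearForm x (br (x i) (x j))} ∪
  {f | ∃ i j t, i < j ∧ f = of k j ⊢ᵈ of k i ⊢ᵈ of k t - of k i ⊢ᵈ of k j ⊢ᵈ of k t
    + linearForm x (br (x i) (x j)) ⊢ᵈ of k t} ∪
  {f | ∃ i₀ ∈ I₀, ∃ t, f = of k i₀ ⊢ᵈ of k t} ∪
  {f | ∃ i j t, i < j ∧ f = of k t ⊣ᵈ of k j ⊣ᵈ of k i - of k t ⊣ᵈ of k i ⊣ᵈ of k j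
    + of k t ⊣ᵈ linearForm x (br (x i) (x j))} ∪
  {f | ∃ i₀ ∈ I₀, ∃ t, f = of k t ⊣ᵈ of k i₀}

/-- The pairs `(j, [i₁, …, iₙ])` with `i₁ ≤ ⋯ ≤ iₙ`, all `iₚ ∉ I₀`, and `n ≥ 0`. -/
abbrev PBWIndex [LinearOrder I] (I₀ : Set I) :=
  {p : I × List I // p.2.Pairwise (· ≤ ·) ∧ ∀ i ∈ p.2, i ∉ I₀}

end Leibniz

/-! The compositions are not resolved one by one. Their triviality is deduced from uniqueness of
normal forms modulo the ideal, by comparing two facts.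

Reduction: every diword `u` is a combination of irreducible diwords `xₜ ⊣ x_{i₁} ⊣ ⋯ ⊣ x_{iₙ}`
(sorted tail, no tail letter in `I₀`) and of normal `S`-diwords with leading diword at most `u`
(`reduction`). Independence: some linear endomorphism `T` of `D(X)` kills the ideal and fixes the
irreducible diwords (`exists_projection`). If `f` in the ideal is written as `r + m` accordingly,
then `T f = 0` gives `r = 0`, so `f` is a combination of normal `S`-diwords bounded by the diwords
of `f` itself. A composition of type (2) or (3) lies in the ideal and its leading terms cancel, so
this bound is the one that triviality demands; for the multiplication compositions the bound is the
degree. The basis of `U(L)` and the embedding come from the same two facts.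

To construct `T`, let `K` be the ideal of `k⟨X⟩` generated by all `yz - zy - {y,z}`. It contains
`L₀`, and `k⟨X⟩/K` is the enveloping algebra of the Lie algebra `L/L₀`. Bergman's diamond lemma
gives a projection `N` that kills `K` and fixes the sorted words without letters from `I₀`
(`exists_pbw_projection`). Let `L` act on `L ⊗ k⟨X⟩` by `y · (v ⊗ u) = v ⊗ yu - {v,y} ⊗ u`. By the
Leibniz identity, `K` acts trivially modulo `L ⊗ K`. Hence, under `a ⊢ xₜ ⊣ b ↦ a · (xₜ ⊗ b)`, the
preimage of `L ⊗ K` is a dialgebra ideal (`isDiIdeal_diRepr`), and it contains the defining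
relations. So `T` is this map followed by `id ⊗ N`, read back as diwords; in effect `U(L)` is `L ⊗
U(L/L₀)`.

Right normed triviality uses the same `T`, since right normed diwords reduce by right normed
`S`-diwords only (`right_reduction`). Left normed triviality concerns only the word before the
center; there the simpler map `a ⊢ xₜ ⊣ b ↦ xₜ ⊗ a` (`preRepr`) takes over. -/

/-! ### A linear diamond lemma -/

section DiamondLemma

variable {k W E α : Type*} [CommRing k] [AddCommGroup E] [Module k E]
  [LT α] [WellFoundedLT α]

open Classical in
/-- The normal form of a basis vector, obtained by performing chosen reductions as long as
possible. -/
noncomputable def diamondNormalForm (b : Module.Basis W k E) (μ : W → α) (red : W → E → Prop) :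
    W → E :=
  (InvImage.wf μ (wellFounded_lt (α := α))).fix fun w nf =>
    if h : ∃ r, red w r then
      -- The guard only makes the recursion well founded: when reductions decrease `μ`, the default
      -- `0` is never taken.
      (b.repr h.choose).sum fun u c => if hu : μ u < μ w then c • nf u hu else 0
    else b w

open Classical in
theorem diamondNormalForm_eq (b : Module.Basis W k E) (μ : W → α) (red : W → E → Prop) (w : W) :
    diamondNormalForm b μ red w = if h : ∃ r, red w r then
      (b.repr h.choose).sum fun u c =>
        if μ u < μ w then c • diamondNormalForm b μ red u else 0
    else b w := by
  rw [diamondNormalForm, WellFounded.fix_eq]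
  rfl

/-- If all reductions decrease a well-founded measure and are locally confluent, then there is a
linear map that is invariant under all reductions and fixes the irreducible basis vectors. -/
theorem exists_normalForm (b : Module.Basis W k E) (μ : W → α) (red : W → E → Prop)
    (hμ : ∀ w r, red w r → r ∈ Submodule.span k (b '' {u | μ u < μ w}))
    (hconf : ∀ w r₁ r₂, red w r₁ → red w r₂ → ∀ N : E →ₗ[k] E,
      (∀ u r, μ u < μ w → red u r → N (b u) = N r) → N r₁ = N r₂) :
    ∃ N : E →ₗ[k] E, (∀ w r, red w r → N (b w) = N r) ∧
      ∀ w, (∀ r, ¬ red w r) → N (b w) = b w := by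
  classical
  set N : E →ₗ[k] E := b.constr k (diamondNormalForm b μ red) with hN
  have hNb : ∀ w, N (b w) = diamondNormalForm b μ red w := fun w => b.constr_basis k _ w
  have hsel : ∀ w (h : ∃ r, red w r), N (b w) = N h.choose := by
    intro w h
    have hs := hμ w _ h.choose_spec
    rw [Module.Basis.mem_span_image] at hs
    rw [hNb, diamondNormalForm_eq, dif_pos h, hN, Module.Basis.constr_apply]
    refine Finsupp.sum_congr fun u hu => ?_
    exact if_pos (hs hu)
  refine ⟨N, ?_, ?_⟩
  · intro w
    induction w using (InvImage.wf μ (wellFounded_lt (α := α))).induction with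
    | _ w ih =>
      intro r hr
      -- Invariance holds by construction for the chosen reduct; local confluence carries it over to
      -- `r`, with the induction hypothesis as the invariance below `w`.
      rw [hsel w ⟨r, hr⟩]
      exact hconf w _ _ (Exists.choose_spec _) hr N fun u r hu hur => ih u hu r hur
  · intro w hw
    rw [hNb, diamondNormalForm_eq, dif_neg]
    rintro ⟨r, hr⟩
    exact hw r hr

end DiamondLemma

/-! ### Inversions of a word -/

section Inversions

variable {I : Type*} [LinearOrder I]

/-- The number of inversions of a word. -/
def inversions : List I → ℕ
  | [] => 0
  | i :: l => l.countP (· < i) + inversions l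

theorem inversions_swap_lt (a b : List I) {i j : I} (h : i < j) :
    inversions (a ++ i :: j :: b) < inversions (a ++ j :: i :: b) := by
  induction a with
  | nil =>
    simp only [List.nil_append, inversions, List.countP_cons, h, h.not_gt, decide_true,
      decide_false, if_true]
    simp
    omega
  | cons m a ih =>
    have hp : (a ++ i :: j :: b).Perm (a ++ j :: i :: b) := (List.Perm.swap j i b).append_left a
    simp only [List.cons_append, inversions, hp.countP_eq]
    omega

/-- The measure of a word by its length and its number of inversions. -/
def wordMeasure (l : List I) : ℕ ×ₗ ℕ := toLex (l.length, inversions l)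

theorem wordMeasure_lt_of_length_lt {l l' : List I} (h : l.length < l'.length) :
    wordMeasure l < wordMeasure l' :=
  Prod.Lex.toLex_lt_toLex.2 (Or.inl h)

theorem wordMeasure_swap_lt (a b : List I) {i j : I} (h : i < j) :
    wordMeasure (a ++ i :: j :: b) < wordMeasure (a ++ j :: i :: b) :=
  Prod.Lex.toLex_lt_toLex.2 (Or.inr ⟨by simp, inversions_swap_lt a b h⟩)

/-- A word that is not sorted has a descent. -/
theorem exists_descent {l : List I} (h : ¬ l.Pairwise (· ≤ ·)) :
    ∃ a b i j, i < j ∧ l = a ++ j :: i :: b := by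
  induction l with
  | nil => simp at h
  | cons m l ih =>
    by_cases hl : l.Pairwise (· ≤ ·)
    · cases l with
      | nil => simp at h
      | cons n l =>
        refine ⟨[], l, n, m, ?_, rfl⟩
        by_contra hmn
        rw [not_lt] at hmn
        refine h (List.pairwise_cons.2 ⟨fun p hp => ?_, hl⟩)
        rcases List.mem_cons.1 hp with rfl | hp
        · exact hmn
        · exact hmn.trans ((List.pairwise_cons.1 hl).1 p hp)
    · obtain ⟨a, b, i, j, hij, rfl⟩ := ih hl
      exact ⟨m :: a, b, i, j, hij, rfl⟩

theorem not_pairwise_of_descent (a b : List I) {i j : I} (h : i < j) :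
    ¬ (a ++ j :: i :: b).Pairwise (· ≤ ·) := by
  intro hp
  have := (List.pairwise_append.1 hp).2.1
  exact h.not_ge ((List.pairwise_cons.1 this).1 i (by simp))

end Inversions

/-! ### The subspace `L₀` of a Leibniz algebra -/

section LeibnizKernel

variable {k L : Type*} [CommRing k] [AddCommGroup L] [Module k L] {br : L →ₗ[k] L →ₗ[k] L}

theorem br_self_mem_leibnizKernel (a : L) : br a a ∈ leibnizKernel br :=
  Submodule.subset_span (Or.inl ⟨a, rfl⟩)

theorem br_add_br_mem_leibnizKernel (a b : L) : br a b + br b a ∈ leibnizKernel br :=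
  Submodule.subset_span (Or.inr ⟨a, b, rfl⟩)

/-- The Leibniz identity for `(y, a, a)` reads `{{y,a},a} = {{y,a},a} + {y,{a,a}}`; for `{a,b} +
{b,a}`, substitute the identity for `(y, b, a)` into the one for `(y, a, b)`. -/
theorem br_leibnizKernel_right (hbr : IsLeibniz br) (y : L) {z : L} (hz : z ∈ leibnizKernel br) :
    br y z = 0 := by
  suffices h : leibnizKernel br ≤ LinearMap.ker (br y) from h hz
  refine Submodule.span_le.2 ?_
  rintro _ (⟨a, rfl⟩ | ⟨a, b, rfl⟩)
  · have := hbr y a a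
    simpa using this
  · have h1 := hbr y a b
    have h2 := hbr y b a
    rw [h2, add_assoc, left_eq_add] at h1
    simpa [add_comm] using h1

/-- Since `{y,z} = 0`, the product `{z,y}` equals the generator `{z,y} + {y,z}`. Thus `L₀` is a
two-sided ideal. -/
theorem br_leibnizKernel_left (hbr : IsLeibniz br) {z : L} (hz : z ∈ leibnizKernel br) (y : L) :
    br z y ∈ leibnizKernel br := by
  have h := br_add_br_mem_leibnizKernel (br := br) z y
  rwa [br_leibnizKernel_right hbr y hz, add_zero] at h

end LeibnizKernel

/-- A linear map sends everything into a submodule if it does so for a basis. -/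
theorem Module.Basis.map_mem_of_forall {k L E I : Type*} [CommRing k] [AddCommGroup L] [Module k L]
    [AddCommGroup E] [Module k E] (x : Module.Basis I k L) {Q : Submodule k E} (f : L →ₗ[k] E)
    (h : ∀ i, f (x i) ∈ Q) (z : L) : f z ∈ Q := by
  have hz : z ∈ Submodule.span k (Set.range x) := by rw [x.span_eq]; trivial
  exact (Submodule.span_le (p := Q.comap f)).2 (by rintro _ ⟨i, rfl⟩; exact h i) hz

/-! ### Words in the free associative algebra -/

section Words

open FreeAlgebra

variable {k I : Type*} [CommRing k]

variable (k) in
/-- A word as an element of the free associative algebra. -/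
noncomputable def algWord (l : List I) : FreeAlgebra k I := (l.map (ι k)).prod

@[simp]
theorem algWord_nil : algWord k ([] : List I) = 1 := by simp [algWord]

@[simp]
theorem algWord_cons (i : I) (l : List I) : algWord k (i :: l) = ι k i * algWord k l := by
  simp [algWord]

@[simp]
theorem algWord_append (l l' : List I) : algWord k (l ++ l') = algWord k l * algWord k l' := by
  simp [algWord]

variable (k I) in
/-- The words form a basis of the free associative algebra. -/
noncomputable def wordBasis : Module.Basis (List I) k (FreeAlgebra k I) :=
  (FreeAlgebra.basisFreeMonoid k I).reindex FreeMonoid.toList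

@[simp]
theorem wordBasis_apply (l : List I) : wordBasis k I l = algWord k l := by
  simp [wordBasis, FreeAlgebra.basisFreeMonoid, equivMonoidAlgebraFreeMonoid, algWord,
    FreeMonoid.lift_apply, MonoidAlgebra.coeffLinearEquiv]

end Words

/-! ### Commutator relations in the free associative algebra -/

section Commutators

open FreeAlgebra

variable {k L I : Type*} [CommRing k] [AddCommGroup L] [Module k L]

/-- The linear map `L → k⟨X⟩` sending the basis vector `xᵢ` to the generator `xᵢ`. -/
noncomputable def algForm (x : Module.Basis I k L) : L →ₗ[k] FreeAlgebra k I :=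
  x.constr k (ι k)

@[simp]
theorem algForm_basis (x : Module.Basis I k L) (i : I) : algForm x (x i) = ι k i :=
  x.constr_basis k _ i

/-- `y z - z y - {y,z}` as a bilinear map. -/
noncomputable def commRelation (br : L →ₗ[k] L →ₗ[k] L) (x : Module.Basis I k L) :
    L →ₗ[k] L →ₗ[k] FreeAlgebra k I :=
  (LinearMap.mul k (FreeAlgebra k I)).compl₁₂ (algForm x) (algForm x)
    - (LinearMap.mul k (FreeAlgebra k I)).flip.compl₁₂ (algForm x) (algForm x)
    - br.compr₂ (algForm x)

theorem commRelation_apply (br : L →ₗ[k] L →ₗ[k] L) (x : Module.Basis I k L) (y z : L) :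
    commRelation br x y z
      = algForm x y * algForm x z - algForm x z * algForm x y - algForm x (br y z) := by
  simp [commRelation]

/-- Multiplication by words from both sides. -/
noncomputable def sandwich (a b : List I) : FreeAlgebra k I →ₗ[k] FreeAlgebra k I :=
  LinearMap.mulLeft k (algWord k a) ∘ₗ LinearMap.mulRight k (algWord k b)

theorem sandwich_apply (a b : List I) (f : FreeAlgebra k I) :
    sandwich a b f = algWord k a * f * algWord k b := by
  simp [sandwich, mul_assoc]

theorem sandwich_algForm_mem {x : Module.Basis I k L} {Q : Submodule k (FreeAlgebra k I)}
    {a b : List I} (h : ∀ i, algWord k (a ++ i :: b) ∈ Q) (z : L) :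
    sandwich a b (algForm x z) ∈ Q :=
  x.map_mem_of_forall (sandwich a b ∘ₗ algForm x)
    (fun i => by simpa [sandwich_apply, mul_assoc] using h i) z

/-- The ideal of the free associative algebra generated by `xᵢ xⱼ - xⱼ xᵢ - {xᵢ,xⱼ}`. -/
noncomputable def commIdeal (br : L →ₗ[k] L →ₗ[k] L) (x : Module.Basis I k L) :
    Submodule k (FreeAlgebra k I) :=
  Submodule.span k {f | ∃ a b i j, f = sandwich a b (commRelation br x (x i) (x j))}

theorem word_induction {Q : Submodule k (FreeAlgebra k I)} (h : ∀ l, algWord k l ∈ Q)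
    (f : FreeAlgebra k I) : f ∈ Q :=
  (wordBasis k I).map_mem_of_forall LinearMap.id (by simpa using h) f

theorem mul_mem_commIdeal_left {br : L →ₗ[k] L →ₗ[k] L} {x : Module.Basis I k L}
    (g : FreeAlgebra k I) {f : FreeAlgebra k I} (hf : f ∈ commIdeal br x) :
    g * f ∈ commIdeal br x := by
  refine word_induction (Q := (commIdeal br x).comap (LinearMap.mulRight k f)) (fun l => ?_) g
  refine (Submodule.span_le (p := (commIdeal br x).comap (LinearMap.mulLeft k (algWord k l)))).2
    ?_ hf
  rintro _ ⟨a, b, i, j, rfl⟩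
  exact Submodule.subset_span ⟨l ++ a, b, i, j, by simp [sandwich_apply, mul_assoc]⟩

theorem mul_mem_commIdeal_right {br : L →ₗ[k] L →ₗ[k] L} {x : Module.Basis I k L}
    {f : FreeAlgebra k I} (g : FreeAlgebra k I) (hf : f ∈ commIdeal br x) :
    f * g ∈ commIdeal br x := by
  refine word_induction (Q := (commIdeal br x).comap (LinearMap.mulLeft k f)) (fun l => ?_) g
  refine (Submodule.span_le (p := (commIdeal br x).comap (LinearMap.mulRight k (algWord k l)))).2
    ?_ hf
  rintro _ ⟨a, b, i, j, rfl⟩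
  exact Submodule.subset_span ⟨a, b ++ l, i, j, by simp [sandwich_apply, mul_assoc]⟩

theorem commRelation_mem (br : L →ₗ[k] L →ₗ[k] L) (x : Module.Basis I k L) (y z : L) :
    commRelation br x y z ∈ commIdeal br x := by
  refine x.map_mem_of_forall ((commRelation br x).flip z) (fun i => ?_) y
  refine x.map_mem_of_forall (commRelation br x (x i)) (fun j => ?_) z
  exact Submodule.subset_span ⟨[], [], i, j, by simp [sandwich_apply]⟩

end Commutators

/-! ### Normal forms modulo the commutator relations -/

section NormalForm

open FreeAlgebra

variable {k L I : Type*} [CommRing k] [AddCommGroup L] [Module k L] [LinearOrder I]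

/-- The reductions `xⱼ xᵢ → xᵢ xⱼ - {xᵢ,xⱼ}` for `i < j` and `xᵢ → 0` for `i ∈ I₀`, inside words. -/
inductive WordRed (br : L →ₗ[k] L →ₗ[k] L) (x : Module.Basis I k L) (I₀ : Set I) :
    List I → FreeAlgebra k I → Prop
  | swap (a b : List I) {i j : I} (h : i < j) : WordRed br x I₀ (a ++ j :: i :: b)
      (sandwich a b (ι k i * ι k j - algForm x (br (x i) (x j))))
  | kill (a b : List I) {i : I} (h : i ∈ I₀) : WordRed br x I₀ (a ++ i :: b) 0

variable {br : L →ₗ[k] L →ₗ[k] L} {x : Module.Basis I k L} {I₀ : Set I}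

/-- A swap keeps the length and removes an inversion; the bracket term is a combination of words
shorter by one letter. -/
theorem WordRed.mem_span {w : List I} {r : FreeAlgebra k I} (h : WordRed br x I₀ w r) :
    r ∈ Submodule.span k (wordBasis k I '' {u | wordMeasure u < wordMeasure w}) := by
  cases h with
  | kill a b h => exact zero_mem _
  | @swap a b i j h =>
    rw [map_sub]
    refine sub_mem (Submodule.subset_span ⟨a ++ i :: j :: b, wordMeasure_swap_lt a b h, ?_⟩)
      (sandwich_algForm_mem (fun m => ?_) _)
    · simp [sandwich_apply, mul_assoc]
    · exact Submodule.subset_span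
        ⟨a ++ m :: b, wordMeasure_lt_of_length_lt (by simp), wordBasis_apply _⟩

/-- Invariance under all reductions of words below `w`. -/
def InvariantBelow (br : L →ₗ[k] L →ₗ[k] L) (x : Module.Basis I k L) (I₀ : Set I) (w : List I)
    (N : FreeAlgebra k I →ₗ[k] FreeAlgebra k I) : Prop :=
  ∀ u r, wordMeasure u < wordMeasure w → WordRed br x I₀ u r → N (algWord k u) = N r

namespace InvariantBelow

variable {w : List I} {N : FreeAlgebra k I →ₗ[k] FreeAlgebra k I}

theorem swap (hN : InvariantBelow br x I₀ w N) {a b : List I} {i j : I} (h : i < j)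
    (hw : wordMeasure (a ++ j :: i :: b) < wordMeasure w) :
    N (sandwich a b (ι k j * ι k i))
      = N (sandwich a b (ι k i * ι k j)) - N (sandwich a b (algForm x (br (x i) (x j)))) := by
  have := hN _ _ hw (.swap a b h)
  rw [← map_sub, ← map_sub, ← this]
  simp [sandwich_apply, mul_assoc]

theorem kill (hN : InvariantBelow br x I₀ w N) {a b : List I} {i : I} (h : i ∈ I₀)
    (hw : wordMeasure (a ++ i :: b) < wordMeasure w) : N (algWord k (a ++ i :: b)) = 0 := by
  simpa using hN _ _ hw (.kill a b h)

theorem kernel (hN : InvariantBelow br x I₀ w N)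
    (hI₀ : Submodule.span k (x '' I₀) = leibnizKernel br) {a b : List I} {z : L}
    (hz : z ∈ leibnizKernel br) (hw : a.length + b.length + 1 < w.length) :
    N (sandwich a b (algForm x z)) = 0 := by
  rw [← hI₀] at hz
  refine (Submodule.span_le (p := LinearMap.ker (N ∘ₗ sandwich a b ∘ₗ algForm x))).2 ?_ hz
  rintro _ ⟨i, hi, rfl⟩
  have := hN.kill (a := a) (b := b) hi (wordMeasure_lt_of_length_lt (by simp; omega))
  simpa [sandwich_apply, mul_assoc] using this

/-- By bilinearity only pairs of letters matter. One order of distinct letters is a reduction; the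
other order leaves `{xᵢ,xⱼ} + {xⱼ,xᵢ}` and equal letters leave `{xᵢ,xᵢ}`, both killed because they
lie in `L₀`. -/
theorem comm (hN : InvariantBelow br x I₀ w N)
    (hI₀ : Submodule.span k (x '' I₀) = leibnizKernel br) {a b : List I}
    (hw : a.length + b.length + 2 < w.length) (y z : L) :
    N (sandwich a b (commRelation br x y z)) = 0 := by
  refine x.map_mem_of_forall (Q := ⊥) (N ∘ₗ sandwich a b ∘ₗ (commRelation br x).flip z)
    (fun i => ?_) y
  refine x.map_mem_of_forall (Q := ⊥) (N ∘ₗ sandwich a b ∘ₗ commRelation br x (x i))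
    (fun j => ?_) z
  have hlt : ∀ p q : I, wordMeasure (a ++ p :: q :: b) < wordMeasure w := fun p q =>
    wordMeasure_lt_of_length_lt (by simp; omega)
  rw [Submodule.mem_bot, LinearMap.comp_apply, LinearMap.comp_apply, commRelation_apply,
    algForm_basis, algForm_basis, map_sub, map_sub, map_sub, map_sub]
  rcases lt_trichotomy i j with h | rfl | h
  · rw [hN.swap h (hlt _ _)]; abel
  · rw [hN.kernel hI₀ (br_self_mem_leibnizKernel _) (by omega)]; abel
  · have hk := hN.kernel (a := a) (b := b) hI₀ (br_add_br_mem_leibnizKernel (x i) (x j)) (by omega)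
    rw [map_add, map_add, map_add] at hk
    rw [hN.swap h (hlt _ _)]
    linear_combination (norm := abel) -hk

end InvariantBelow

/-- The swapped word still contains the letter `m` and dies. In the bracket term, `m` survives if it
lies outside the swapped pair; otherwise the bracket is `{xᵢ,xₘ} = 0` or `{xₘ,xⱼ} ∈ L₀`. -/
theorem WordRed.confluent_kill_swap (hbr : IsLeibniz br)
    (hI₀ : Submodule.span k (x '' I₀) = leibnizKernel br)
    {N : FreeAlgebra k I →ₗ[k] FreeAlgebra k I} {a b a' b' : List I} {m i j : I}
    (hm : m ∈ I₀) (hij : i < j) (he : a ++ m :: b = a' ++ j :: i :: b')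
    (hN : InvariantBelow br x I₀ (a ++ m :: b) N) :
    N (sandwich a' b' (ι k i * ι k j - algForm x (br (x i) (x j)))) = 0 := by
  have hker : ∀ p ∈ I₀, x p ∈ leibnizKernel br := fun p hp =>
    hI₀ ▸ Submodule.subset_span ⟨p, hp, rfl⟩
  have hw : m ∈ a' ++ i :: j :: b' := by
    have : m ∈ a' ++ j :: i :: b' := he ▸ by simp
    simp only [List.mem_append, List.mem_cons] at this ⊢
    tauto
  have hlen : a'.length + b'.length + 1 < (a ++ m :: b).length := by rw [he]; simp; omega
  have h1 : N (sandwich a' b' (ι k i * ι k j)) = 0 := by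
    obtain ⟨c, d, hcd⟩ := List.append_of_mem hw
    have := hN.kill (a := c) (b := d) hm (by rw [← hcd, he]; exact wordMeasure_swap_lt _ _ hij)
    rw [← hcd] at this
    simpa [sandwich_apply, mul_assoc] using this
  rw [map_sub, map_sub, h1, zero_sub, neg_eq_zero]
  have hmem : m ∈ a' ++ j :: i :: b' := he ▸ by simp
  simp only [List.mem_append, List.mem_cons] at hmem
  rcases hmem with h | rfl | rfl | h
  · refine sandwich_algForm_mem (Q := LinearMap.ker N) (fun p => ?_) _
    obtain ⟨c, d, rfl⟩ := List.append_of_mem h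
    have := hN.kill (a := c) (b := d ++ p :: b') hm
      (wordMeasure_lt_of_length_lt (by simp at hlen ⊢; omega))
    simpa using this
  · rw [br_leibnizKernel_right hbr _ (hker _ hm)]; simp
  · exact hN.kernel hI₀ (br_leibnizKernel_left hbr (hker _ hm) _) hlen
  · refine sandwich_algForm_mem (Q := LinearMap.ker N) (fun p => ?_) _
    obtain ⟨c, d, rfl⟩ := List.append_of_mem h
    have := hN.kill (a := a' ++ p :: c) (b := d) hm
      (wordMeasure_lt_of_length_lt (by simp at hlen ⊢; omega))
    simpa using this

/-- Performing the other swap on either side leads to the same four terms, the last being the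
product of both brackets. -/
theorem WordRed.confluent_disjoint {N : FreeAlgebra k I →ₗ[k] FreeAlgebra k I}
    {a b c : List I} {i j p q : I} (hij : i < j) (hpq : p < q)
    (hN : InvariantBelow br x I₀ (a ++ j :: i :: (b ++ q :: p :: c)) N) :
    N (sandwich a (b ++ q :: p :: c) (ι k i * ι k j - algForm x (br (x i) (x j))))
      = N (sandwich (a ++ j :: i :: b) c (ι k p * ι k q - algForm x (br (x p) (x q)))) := by
  have e1 := hN.swap (a := a ++ i :: j :: b) (b := c) hpq
    (by simpa using wordMeasure_swap_lt a (b ++ q :: p :: c) hij)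
  have e2 := hN.swap (a := a) (b := b ++ p :: q :: c) hij
    (by simpa using wordMeasure_swap_lt (a ++ j :: i :: b) c hpq)
  have e3 : N (sandwich a (b ++ q :: p :: c) (algForm x (br (x i) (x j))))
      = N (sandwich a (b ++ p :: q :: c) (algForm x (br (x i) (x j))))
        - N (algWord k a * algForm x (br (x i) (x j)) * algWord k b
          * algForm x (br (x p) (x q)) * algWord k c) := by
    -- With the bracket replaced by an arbitrary vector, linearity reduces the claim to a single
    -- letter in its place. The word is then shorter than the original, so the other swap is
    -- available.
    generalize br (x i) (x j) = z
    have hz := x.map_mem_of_forall (Q := ⊥)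
      (N ∘ₗ (sandwich a (b ++ q :: p :: c) - (sandwich a (b ++ p :: q :: c)
        - LinearMap.mulLeft k (algWord k a) ∘ₗ LinearMap.mulRight k (algWord k b
          * algForm x (br (x p) (x q)) * algWord k c))) ∘ₗ algForm x) ?_ z
    swap
    · intro m
      have := hN.swap (a := a ++ m :: b) (b := c) hpq
        (wordMeasure_lt_of_length_lt (by simp))
      simp only [sandwich_apply, algWord_append, algWord_cons, mul_assoc] at this
      simp [sandwich_apply, mul_assoc, this]
    · exact sub_eq_zero.1 (by simpa [sandwich_apply, mul_assoc] using hz)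
  have e4 : N (sandwich (a ++ j :: i :: b) c (algForm x (br (x p) (x q))))
      = N (sandwich (a ++ i :: j :: b) c (algForm x (br (x p) (x q))))
        - N (algWord k a * algForm x (br (x i) (x j)) * algWord k b
          * algForm x (br (x p) (x q)) * algWord k c) := by
    generalize br (x p) (x q) = z
    have hz := x.map_mem_of_forall (Q := ⊥)
      (N ∘ₗ (sandwich (a ++ j :: i :: b) c - (sandwich (a ++ i :: j :: b) c
        - LinearMap.mulLeft k (algWord k a * algForm x (br (x i) (x j)) * algWord k b)
          ∘ₗ LinearMap.mulRight k (algWord k c))) ∘ₗ algForm x) ?_ z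
    swap
    · intro m
      have := hN.swap (a := a) (b := b ++ m :: c) hij
        (wordMeasure_lt_of_length_lt (by simp))
      simp only [sandwich_apply, algWord_append, algWord_cons, mul_assoc] at this
      simp [sandwich_apply, mul_assoc, this]
    · exact sub_eq_zero.1 (by simpa [sandwich_apply, mul_assoc] using hz)
  rw [map_sub, map_sub, map_sub, map_sub, e3, e4]
  simp only [sandwich_apply, algWord_append, algWord_cons, mul_assoc] at e1 e2 ⊢
  rw [e1, e2]
  abel

/-- Both ways of sorting `xₘ xⱼ xᵢ` end in `xᵢ xⱼ xₘ` up to words with one bracket and one letter.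
Commuting these costs the Jacobi sum, which vanishes by the Leibniz identity together with
`{xᵢ,{xⱼ,xₘ}} + {{xⱼ,xₘ},xᵢ} ∈ L₀`. -/
theorem WordRed.confluent_overlap (hbr : IsLeibniz br)
    (hI₀ : Submodule.span k (x '' I₀) = leibnizKernel br)
    {N : FreeAlgebra k I →ₗ[k] FreeAlgebra k I}
    {a b : List I} {i j m : I} (hij : i < j) (hjm : j < m)
    (hN : InvariantBelow br x I₀ (a ++ m :: j :: i :: b) N) :
    N (sandwich a (i :: b) (ι k j * ι k m - algForm x (br (x j) (x m))))
      = N (sandwich (a ++ [m]) b (ι k i * ι k j - algForm x (br (x i) (x j)))) := by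
  have e1 := hN.swap (a := a ++ [j]) (b := b) (hij.trans hjm)
    (by simpa using wordMeasure_swap_lt a (i :: b) hjm)
  have e2 := hN.swap (a := a) (b := m :: b) hij
    ((by simpa using wordMeasure_swap_lt (a ++ [j]) b (hij.trans hjm) :
      wordMeasure (a ++ j :: i :: m :: b) < wordMeasure (a ++ j :: m :: i :: b)).trans
      (wordMeasure_swap_lt a (i :: b) hjm))
  have e3 := hN.swap (a := a) (b := j :: b) (hij.trans hjm)
    (by simpa using wordMeasure_swap_lt (a ++ [m]) b hij)
  have e4 := hN.swap (a := a ++ [i]) (b := b) hjm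
    ((by simpa using wordMeasure_swap_lt a (j :: b) (hij.trans hjm) :
      wordMeasure (a ++ [i] ++ m :: j :: b) < wordMeasure (a ++ m :: i :: j :: b)).trans
      (by simpa using wordMeasure_swap_lt (a ++ [m]) b hij))
  have c1 := hN.comm (a := a) (b := b) hI₀ (by simp; omega) (br (x i) (x j)) (x m)
  have c2 := hN.comm (a := a) (b := b) hI₀ (by simp; omega) (br (x i) (x m)) (x j)
  have c3 := hN.comm (a := a) (b := b) hI₀ (by simp; omega) (br (x j) (x m)) (x i)
  have c4 := hN.kernel (a := a) (b := b) hI₀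
    (br_add_br_mem_leibnizKernel (x i) (br (x j) (x m))) (by simp; omega)
  rw [commRelation_apply, hbr] at c1
  rw [commRelation_apply] at c2 c3
  simp only [map_sub, map_add, algForm_basis, sandwich_apply, algWord_append, algWord_cons,
    algWord_nil, mul_one, mul_assoc] at *
  rw [e1, e2, e3, e4]
  linear_combination (norm := abel) c2 - c1 - c3 - c4

/-- The length of `c` is the offset between the swaps: `0` means the same swap, `1` an overlap in
one letter, and at least `2` disjoint pairs. -/
theorem WordRed.confluent_swap_swap (hbr : IsLeibniz br)
    (hI₀ : Submodule.span k (x '' I₀) = leibnizKernel br)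
    {N : FreeAlgebra k I →ₗ[k] FreeAlgebra k I} {a c b b' : List I} {i j p q : I}
    (hij : i < j) (hpq : p < q) (he : j :: i :: b = c ++ q :: p :: b')
    (hN : InvariantBelow br x I₀ (a ++ j :: i :: b) N) :
    N (sandwich a b (ι k i * ι k j - algForm x (br (x i) (x j))))
      = N (sandwich (a ++ c) b' (ι k p * ι k q - algForm x (br (x p) (x q)))) := by
  match c, he with
  | [], he =>
    simp only [List.nil_append, List.cons.injEq] at he
    obtain ⟨rfl, rfl, rfl⟩ := he
    simp
  | [_], he =>
    simp only [List.cons_append, List.nil_append, List.cons.injEq] at he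
    obtain ⟨rfl, rfl, rfl⟩ := he
    exact WordRed.confluent_overlap hbr hI₀ hpq hij hN
  | _ :: _ :: c, he =>
    simp only [List.cons_append, List.cons.injEq] at he
    obtain ⟨rfl, rfl, rfl⟩ := he
    exact WordRed.confluent_disjoint hij hpq hN

theorem WordRed.confluent (hbr : IsLeibniz br)
    (hI₀ : Submodule.span k (x '' I₀) = leibnizKernel br)
    {N : FreeAlgebra k I →ₗ[k] FreeAlgebra k I} {w : List I} {r r' : FreeAlgebra k I}
    (h : WordRed br x I₀ w r) (h' : WordRed br x I₀ w r')
    (hN : InvariantBelow br x I₀ w N) : N r = N r' := by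
  generalize hw : w = w' at h'
  cases h with
  | kill a b hm =>
    cases h' with
    | kill => rfl
    | swap a' b' hij => rw [map_zero, WordRed.confluent_kill_swap hbr hI₀ hm hij hw hN]
  | swap a b hij =>
    cases h' with
    | kill a' b' hm =>
      rw [map_zero, WordRed.confluent_kill_swap hbr hI₀ hm hij hw.symm (hw ▸ hN)]
    | swap a' b' hpq =>
      rcases List.append_eq_append_iff.1 hw with ⟨c, rfl, hc⟩ | ⟨c, rfl, hc⟩
      · exact WordRed.confluent_swap_swap hbr hI₀ hij hpq hc hN
      · exact (WordRed.confluent_swap_swap hbr hI₀ hpq hij hc (hw ▸ hN)).symm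

/-- There is a linear projection that kills the commutator ideal and fixes the sorted words
without letters from `I₀`. -/
theorem exists_pbw_projection (hbr : IsLeibniz br)
    (hI₀ : Submodule.span k (x '' I₀) = leibnizKernel br) :
    ∃ N : FreeAlgebra k I →ₗ[k] FreeAlgebra k I, (∀ f ∈ commIdeal br x, N f = 0) ∧
      ∀ l : List I, l.Pairwise (· ≤ ·) → (∀ i ∈ l, i ∉ I₀) → N (algWord k l) = algWord k l := by
  obtain ⟨N, hN, hfix⟩ := exists_normalForm (wordBasis k I) wordMeasure (WordRed br x I₀)
    (fun _ _ h => h.mem_span) (fun w r₁ r₂ h₁ h₂ N hN => h₁.confluent hbr hI₀ h₂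
      (fun u r hu hr => by simpa using hN u r hu hr))
  simp only [wordBasis_apply] at hN hfix
  refine ⟨N, ?_, ?_⟩
  · refine fun f hf => (Submodule.span_le (p := LinearMap.ker N)).2 ?_ hf
    rintro _ ⟨a, b, i, j, rfl⟩
    -- Here `N` is invariant everywhere, so any bounding word will do; three extra letters satisfy
    -- the length condition of `comm`.
    have : InvariantBelow br x I₀ (i :: i :: i :: (a ++ b)) N := fun u r _ h => hN u r h
    exact this.comm hI₀ (by simp) _ _
  · intro l hl hl₀
    refine hfix l fun r hr => ?_
    cases hr with
    | swap a b h => exact not_pairwise_of_descent a b h hl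
    | kill a b h => exact hl₀ _ (by simp) h

end NormalForm

/-! ### Multiplications of the free dialgebra on diwords -/

namespace FreeDialgebra

variable {k X : Type*} [CommRing k]

theorem dashv_eq_bilin (f g : FreeDialgebra k X) : f ⊣ᵈ g = bilin Diword.dashv f g := rfl

theorem vdash_eq_bilin (f g : FreeDialgebra k X) : f ⊢ᵈ g = bilin Diword.vdash f g := rfl

theorem ofWord_dashv_ofWord (u v : Diword X) :
    ofWord k u ⊣ᵈ ofWord k v = ofWord k (u.dashv v) := by
  simp [dashv_eq_bilin, ofWord, bilin_single]

theorem ofWord_vdash_ofWord (u v : Diword X) :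
    ofWord k u ⊢ᵈ ofWord k v = ofWord k (u.vdash v) := by
  simp [vdash_eq_bilin, ofWord, bilin_single]

theorem of_eq_ofWord (i : X) : of k i = ofWord k ⟨[], i, []⟩ := rfl

/-- Linear maps on the free dialgebra agree if they agree on diwords. -/
theorem linearMap_ext_ofWord {E : Type*} [AddCommGroup E] [Module k E]
    {F G : FreeDialgebra k X →ₗ[k] E} (h : ∀ u, F (ofWord k u) = G (ofWord k u)) : F = G :=
  Finsupp.lhom_ext' fun u => LinearMap.ext_ring (h u)

theorem map_mem_of_ofWord {E : Type*} [AddCommGroup E] [Module k E] {Q : Submodule k E}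
    (F : FreeDialgebra k X →ₗ[k] E) (h : ∀ u, F (ofWord k u) ∈ Q) (f : FreeDialgebra k X) :
    F f ∈ Q :=
  (Finsupp.basisSingleOne (R := k)).map_mem_of_forall F (by simpa [ofWord] using h) f

/-- Bilinear maps on the free dialgebra agree if they agree on diwords. -/
theorem bilinearMap_ext_ofWord {E : Type*} [AddCommGroup E] [Module k E]
    {F G : FreeDialgebra k X →ₗ[k] FreeDialgebra k X →ₗ[k] E}
    (h : ∀ u v, F (ofWord k u) (ofWord k v) = G (ofWord k u) (ofWord k v)) : F = G :=
  linearMap_ext_ofWord fun u => linearMap_ext_ofWord (h u)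

/-- A linear map from the free dialgebra, given by its values on diwords. -/
noncomputable def wordLift {E : Type*} [AddCommGroup E] [Module k E] (F : Diword X → E) :
    FreeDialgebra k X →ₗ[k] E := Finsupp.linearCombination k F

@[simp]
theorem wordLift_ofWord {E : Type*} [AddCommGroup E] [Module k E] (F : Diword X → E)
    (u : Diword X) : wordLift F (ofWord k u) = F u := by
  simp [wordLift, ofWord]

end FreeDialgebra

/-! ### A dialgebra representation on `L ⊗ k⟨X⟩` -/

section Representation

open FreeDialgebra TensorProduct

variable {k L I : Type*} [CommRing k] [AddCommGroup L] [Module k L]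

/-- The associative word underlying a diword, extended linearly. -/
noncomputable def toFreeAlgebra : FreeDialgebra k I →ₗ[k] FreeAlgebra k I :=
  wordLift fun u => algWord k u.letters

theorem toFreeAlgebra_ofWord (u : Diword I) :
    toFreeAlgebra (ofWord k u) = algWord k u.letters := by simp [toFreeAlgebra]

theorem toFreeAlgebra_of (i : I) : toFreeAlgebra (of k i) = FreeAlgebra.ι k i := by
  simp [of_eq_ofWord, toFreeAlgebra_ofWord, Diword.letters]

theorem toFreeAlgebra_vdash (f g : FreeDialgebra k I) :
    toFreeAlgebra (f ⊢ᵈ g) = toFreeAlgebra f * toFreeAlgebra g := by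
  have h : (bilin Diword.vdash).compr₂ (toFreeAlgebra (k := k) (I := I))
      = (LinearMap.mul k _).compl₁₂ toFreeAlgebra toFreeAlgebra :=
    bilinearMap_ext_ofWord fun u v => by
      simp [← vdash_eq_bilin, ofWord_vdash_ofWord, toFreeAlgebra_ofWord, Diword.vdash,
        Diword.letters, mul_assoc]
  exact LinearMap.congr_fun₂ h f g

variable (br : L →ₗ[k] L →ₗ[k] L) (x : Module.Basis I k L)

theorem toFreeAlgebra_linearForm (z : L) : toFreeAlgebra (linearForm x z) = algForm x z := by
  have : toFreeAlgebra ∘ₗ linearForm x = algForm x := x.ext fun i => by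
    simp [linearForm, toFreeAlgebra_of]
  exact LinearMap.congr_fun this z

/-- The action `y · (v ⊗ u) = v ⊗ y u - {v,y} ⊗ u` of `L` on `L ⊗ k⟨X⟩`. -/
noncomputable def tensorAct (y : L) : Module.End k (L ⊗[k] FreeAlgebra k I) :=
  LinearMap.lTensor L (LinearMap.mulLeft k (algForm x y))
    - LinearMap.rTensor (FreeAlgebra k I) (br.flip y)

theorem tensorAct_tmul (y v : L) (u : FreeAlgebra k I) :
    tensorAct br x y (v ⊗ₜ u) = v ⊗ₜ (algForm x y * u) - br v y ⊗ₜ u := by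
  simp [tensorAct]

/-- The action of the free associative algebra on `L ⊗ k⟨X⟩` from the left. -/
noncomputable def leftAct : FreeAlgebra k I →ₐ[k] Module.End k (L ⊗[k] FreeAlgebra k I) :=
  FreeAlgebra.lift k fun i => tensorAct br x (x i)

theorem leftAct_ι (i : I) : leftAct br x (FreeAlgebra.ι k i) = tensorAct br x (x i) := by
  simp [leftAct]

theorem leftAct_algForm_tmul (y v : L) (u : FreeAlgebra k I) :
    leftAct br x (algForm x y) (v ⊗ₜ u) = v ⊗ₜ (algForm x y * u) - br v y ⊗ₜ u := by
  have : (leftAct br x).toLinearMap.flip (v ⊗ₜ u) ∘ₗ algForm x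
      = TensorProduct.mk k L (FreeAlgebra k I) v ∘ₗ LinearMap.mulRight k u ∘ₗ algForm x
        - (TensorProduct.mk k L (FreeAlgebra k I)).flip u ∘ₗ br v := x.ext fun i => by
    simp [leftAct_ι, tensorAct_tmul]
  exact LinearMap.congr_fun this y

/-- Multiplication of the right factor of `L ⊗ k⟨X⟩` from the right. -/
noncomputable def rightAct : FreeAlgebra k I →ₗ[k] Module.End k (L ⊗[k] FreeAlgebra k I) :=
  LinearMap.lTensorHom L ∘ₗ (LinearMap.mul k (FreeAlgebra k I)).flip

@[simp]
theorem rightAct_tmul (a u : FreeAlgebra k I) (v : L) :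
    rightAct a (v ⊗ₜ u) = v ⊗ₜ[k] (u * a) := by
  simp [rightAct]

theorem leftAct_rightAct (f a : FreeAlgebra k I) (m : L ⊗[k] FreeAlgebra k I) :
    leftAct br x f (rightAct a m) = rightAct a (leftAct br x f m) := by
  induction f using FreeAlgebra.induction generalizing m with
  | grade0 r => simp [Algebra.algebraMap_eq_smul_one]
  | grade1 i =>
    rw [leftAct_ι]
    induction m with
    | zero => simp
    | add m n hm hn => simp only [map_add, hm, hn]
    | tmul v u => simp [tensorAct_tmul, mul_assoc]
  | mul f g hf hg => rw [map_mul, Module.End.mul_apply, hg, hf]; rfl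
  | add f g hf hg => simp only [map_add, LinearMap.add_apply, hf, hg]

/-- The submodule `L ⊗ K`, where `K` is the commutator ideal. -/
noncomputable def tensorIdeal : Submodule k (L ⊗[k] FreeAlgebra k I) :=
  Submodule.span k {m | ∃ v : L, ∃ u ∈ commIdeal br x, m = v ⊗ₜ u}

variable {br x}

theorem tmul_mem_tensorIdeal (v : L) {u : FreeAlgebra k I} (hu : u ∈ commIdeal br x) :
    v ⊗ₜ u ∈ tensorIdeal br x := Submodule.subset_span ⟨v, u, hu, rfl⟩

theorem map_tensorIdeal {E : Type*} [AddCommGroup E] [Module k E]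
    {Q : Submodule k E} (F : L ⊗[k] FreeAlgebra k I →ₗ[k] E)
    (h : ∀ (v : L), ∀ u ∈ commIdeal br x, F (v ⊗ₜ u) ∈ Q) {m : L ⊗[k] FreeAlgebra k I}
    (hm : m ∈ tensorIdeal br x) : F m ∈ Q := by
  refine (Submodule.span_le (p := Q.comap F)).2 ?_ hm
  rintro _ ⟨v, u, hu, rfl⟩
  exact h v u hu

theorem tensor_mem_of_tmul {E : Type*} [AddCommGroup E] [Module k E]
    {Q : Submodule k E} (F : L ⊗[k] FreeAlgebra k I →ₗ[k] E)
    (h : ∀ (v : L) (u : FreeAlgebra k I), F (v ⊗ₜ u) ∈ Q) (m : L ⊗[k] FreeAlgebra k I) :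
    F m ∈ Q := by
  induction m with
  | zero => simp
  | add m n hm hn => rw [map_add]; exact add_mem hm hn
  | tmul v u => exact h v u

theorem rightAct_mem_of_mem (a : FreeAlgebra k I) {m : L ⊗[k] FreeAlgebra k I}
    (hm : m ∈ tensorIdeal br x) : rightAct a m ∈ tensorIdeal br x :=
  map_tensorIdeal (rightAct a) (fun v u hu => by
    simpa using tmul_mem_tensorIdeal v (mul_mem_commIdeal_right a hu)) hm

theorem rightAct_mem {a : FreeAlgebra k I} (ha : a ∈ commIdeal br x)
    (m : L ⊗[k] FreeAlgebra k I) : rightAct a m ∈ tensorIdeal br x :=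
  tensor_mem_of_tmul (rightAct a) (fun v u => by
    simpa using tmul_mem_tensorIdeal v (mul_mem_commIdeal_left u ha)) m

theorem leftAct_mem_of_mem (f : FreeAlgebra k I) {m : L ⊗[k] FreeAlgebra k I}
    (hm : m ∈ tensorIdeal br x) : leftAct br x f m ∈ tensorIdeal br x := by
  induction f using FreeAlgebra.induction generalizing m with
  | grade0 r => simpa [Algebra.algebraMap_eq_smul_one] using Submodule.smul_mem _ r hm
  | grade1 i =>
    rw [leftAct_ι]
    refine map_tensorIdeal (tensorAct br x (x i)) (fun v u hu => ?_) hm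
    rw [tensorAct_tmul]
    exact sub_mem (tmul_mem_tensorIdeal _ (mul_mem_commIdeal_left _ hu))
      (tmul_mem_tensorIdeal _ hu)
  | mul f g hf hg => rw [map_mul]; exact hf (hg hm)
  | add f g hf hg => rw [map_add]; exact add_mem (hf hm) (hg hm)

/-- On `v ⊗ u`, the mixed terms `{v,z} ⊗ yu` and `{v,y} ⊗ zu` cancel, and the terms `{{v,z},y} -
{{v,y},z} + {v,{y,z}}` vanish by the Leibniz identity. Only multiplication of `u` by the relation
remains. -/
theorem leftAct_commRelation_mem (hbr : IsLeibniz br) (y z : L) (m : L ⊗[k] FreeAlgebra k I) :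
    leftAct br x (commRelation br x y z) m ∈ tensorIdeal br x := by
  refine tensor_mem_of_tmul _ (fun v u => ?_) m
  have h : leftAct br x (commRelation br x y z) (v ⊗ₜ u)
      = v ⊗ₜ (commRelation br x y z * u) := by
    simp only [commRelation_apply, map_sub, map_mul, LinearMap.sub_apply, Module.End.mul_apply,
      leftAct_algForm_tmul, sub_mul, TensorProduct.tmul_sub, mul_assoc]
    have := hbr v y z
    rw [this, TensorProduct.add_tmul]
    abel
  rw [h]
  exact tmul_mem_tensorIdeal v (mul_mem_commIdeal_right u (commRelation_mem br x y z))

theorem leftAct_mem (hbr : IsLeibniz br) {f : FreeAlgebra k I} (hf : f ∈ commIdeal br x)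
    (m : L ⊗[k] FreeAlgebra k I) : leftAct br x f m ∈ tensorIdeal br x := by
  refine (Submodule.span_le (p := (tensorIdeal br x).comap
    ((leftAct br x).toLinearMap.flip m))).2 ?_ hf
  rintro _ ⟨a, b, i, j, rfl⟩
  simp only [sandwich_apply, Submodule.comap_coe, Set.mem_preimage, LinearMap.flip_apply,
    AlgHom.toLinearMap_apply, map_mul, Module.End.mul_apply]
  exact leftAct_mem_of_mem _ (leftAct_commRelation_mem hbr _ _ _)

variable (x) in
/-- The multiplication map `v ⊗ u ↦ v u`. -/
noncomputable def tensorMul : L ⊗[k] FreeAlgebra k I →ₗ[k] FreeAlgebra k I :=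
  TensorProduct.lift ((LinearMap.mul k (FreeAlgebra k I)) ∘ₗ algForm x)

theorem tensorMul_tmul (v : L) (u : FreeAlgebra k I) :
    tensorMul x (v ⊗ₜ u) = algForm x v * u := by
  simp [tensorMul]

theorem tensorMul_mem {m : L ⊗[k] FreeAlgebra k I} (hm : m ∈ tensorIdeal br x) :
    tensorMul x m ∈ commIdeal br x :=
  map_tensorIdeal (tensorMul x)
    (fun v u hu => by rw [tensorMul_tmul]; exact mul_mem_commIdeal_left _ hu) hm

/-- For one letter the difference is `(vy - {v,y} - yv)u`, a commutator relation times `u`. So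
multiplying out turns the twisted action into left multiplication modulo `K`. -/
theorem tensorMul_leftAct_sub_mem (l : List I) (m : L ⊗[k] FreeAlgebra k I) :
    tensorMul x (leftAct br x (algWord k l) m) - algWord k l * tensorMul x m
      ∈ commIdeal br x := by
  induction l with
  | nil => simp
  | cons i l ih =>
    have h : ∀ n : L ⊗[k] FreeAlgebra k I,
        tensorMul x (tensorAct br x (x i) n) - FreeAlgebra.ι k i * tensorMul x n
          ∈ commIdeal br x := by
      refine fun n => tensor_mem_of_tmul (tensorMul x ∘ₗ tensorAct br x (x i)
        - LinearMap.mulLeft k (FreeAlgebra.ι k i) ∘ₗ tensorMul x) (fun v u => ?_) n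
      have := mul_mem_commIdeal_right u (commRelation_mem br x v (x i))
      simpa [commRelation_apply, tensorAct_tmul, tensorMul_tmul, sub_mul, mul_assoc,
        sub_right_comm] using this
    have := add_mem (h (leftAct br x (algWord k l) m))
      (mul_mem_commIdeal_left (FreeAlgebra.ι k i) ih)
    simpa [leftAct_ι, mul_sub, mul_assoc] using this

variable (br x) in
/-- The map `D(X) → L ⊗ k⟨X⟩` sending `a ⊢ xₜ ⊣ b` to `a · (xₜ ⊗ b)`. -/
noncomputable def diRepr : FreeDialgebra k I →ₗ[k] L ⊗[k] FreeAlgebra k I :=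
  wordLift fun u => leftAct br x (algWord k u.pre) (x u.center ⊗ₜ algWord k u.post)

theorem diRepr_ofWord (u : Diword I) : diRepr br x (ofWord k u)
    = leftAct br x (algWord k u.pre) (x u.center ⊗ₜ algWord k u.post) := by
  simp [diRepr]

theorem diRepr_vdash (f g : FreeDialgebra k I) :
    diRepr br x (f ⊢ᵈ g) = leftAct br x (toFreeAlgebra f) (diRepr br x g) := by
  have h : (bilin Diword.vdash).compr₂ (diRepr br x)
      = (leftAct br x).toLinearMap.compl₁₂ toFreeAlgebra (diRepr br x) :=
    bilinearMap_ext_ofWord fun u v => by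
      simp [← vdash_eq_bilin, ofWord_vdash_ofWord, toFreeAlgebra_ofWord, Diword.vdash,
        diRepr_ofWord]
  exact LinearMap.congr_fun₂ h f g

theorem diRepr_dashv (f g : FreeDialgebra k I) :
    diRepr br x (f ⊣ᵈ g) = rightAct (toFreeAlgebra g) (diRepr br x f) := by
  have h : (bilin Diword.dashv).compr₂ (diRepr br x)
      = rightAct.flip.compl₁₂ (diRepr br x) toFreeAlgebra :=
    bilinearMap_ext_ofWord fun u v => by
      simp [← dashv_eq_bilin, ofWord_dashv_ofWord, toFreeAlgebra_ofWord, Diword.dashv,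
        diRepr_ofWord, ← leftAct_rightAct]
  exact LinearMap.congr_fun₂ h f g

theorem toFreeAlgebra_sub_mem (f : FreeDialgebra k I) :
    toFreeAlgebra f - tensorMul x (diRepr br x f) ∈ commIdeal br x := by
  refine map_mem_of_ofWord (toFreeAlgebra - tensorMul x ∘ₗ diRepr br x) (fun u => ?_) f
  have := tensorMul_leftAct_sub_mem (br := br) (x := x) u.pre (x u.center ⊗ₜ algWord k u.post)
  rw [← neg_mem_iff, neg_sub] at this
  simpa [toFreeAlgebra_ofWord, diRepr_ofWord, Diword.letters, tensorMul_tmul] using this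

/-- A factor on the non-central side of a product acts only through its associative word. This lemma
brings that word under control once the image in `L ⊗ k⟨X⟩` is. -/
theorem toFreeAlgebra_mem {f : FreeDialgebra k I} (hf : diRepr br x f ∈ tensorIdeal br x) :
    toFreeAlgebra f ∈ commIdeal br x := by
  simpa using add_mem (toFreeAlgebra_sub_mem (br := br) (x := x) f) (tensorMul_mem hf)

theorem diRepr_linearForm (z : L) : diRepr br x (linearForm x z) = z ⊗ₜ 1 := by
  have : diRepr br x ∘ₗ linearForm x = (TensorProduct.mk k L (FreeAlgebra k I)).flip 1 :=
    x.ext fun i => by simp [linearForm, of_eq_ofWord, diRepr_ofWord]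
  exact LinearMap.congr_fun this z

theorem isDiIdeal_diRepr (hbr : IsLeibniz br) :
    IsDiIdeal ((tensorIdeal br x).comap (diRepr br x)) where
  dashv_left a b hb := by
    rw [Submodule.mem_comap, diRepr_dashv]
    exact rightAct_mem (toFreeAlgebra_mem hb) _
  dashv_right b ha := by
    rw [Submodule.mem_comap, diRepr_dashv]
    exact rightAct_mem_of_mem _ ha
  vdash_left a b hb := by
    rw [Submodule.mem_comap, diRepr_vdash]
    exact leftAct_mem_of_mem _ hb
  vdash_right b ha := by
    rw [Submodule.mem_comap, diRepr_vdash]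
    exact leftAct_mem hbr (toFreeAlgebra_mem ha) _

theorem diRepr_mem (hbr : IsLeibniz br) {f : FreeDialgebra k I}
    (hf : f ∈ diIdeal k (envelopingRelations br x)) : diRepr br x f ∈ tensorIdeal br x := by
  refine Submodule.mem_sInf.1 hf ((tensorIdeal br x).comap (diRepr br x))
    ⟨?_, isDiIdeal_diRepr hbr⟩
  rintro _ ⟨i, j, rfl⟩
  have hof : ∀ i, diRepr br x (of k i) = x i ⊗ₜ 1 := fun i => by
    simp [of_eq_ofWord, diRepr_ofWord]
  have : diRepr br x (of k i ⊣ᵈ of k j - of k j ⊢ᵈ of k i - linearForm x (br (x i) (x j))) = 0 := by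
    simp [diRepr_dashv, diRepr_vdash, diRepr_linearForm, hof, toFreeAlgebra_of, leftAct_ι,
      tensorAct_tmul]
  exact (congrArg (· ∈ tensorIdeal br x) this).mpr (zero_mem _)

/-! ### The simplified representation for left normed diwords. -/

variable (x) in
/-- The map `D(X) → L ⊗ k⟨X⟩` sending `a ⊢ xₜ ⊣ b` to `xₜ ⊗ a`. -/
noncomputable def preRepr : FreeDialgebra k I →ₗ[k] L ⊗[k] FreeAlgebra k I :=
  wordLift fun u => x u.center ⊗ₜ algWord k u.pre

theorem preRepr_ofWord (u : Diword I) :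
    preRepr x (ofWord k u) = x u.center ⊗ₜ algWord k u.pre := by simp [preRepr]

theorem preRepr_vdash_ofWord (f : FreeDialgebra k I) (d : Diword I) :
    preRepr x (f ⊢ᵈ ofWord k d) = x d.center ⊗ₜ (toFreeAlgebra f * algWord k d.pre) := by
  have h : preRepr x ∘ₗ (bilin Diword.vdash).flip (ofWord k d)
      = TensorProduct.mk k L (FreeAlgebra k I) (x d.center)
        ∘ₗ LinearMap.mulRight k (algWord k d.pre) ∘ₗ toFreeAlgebra :=
    linearMap_ext_ofWord fun u => by
      simp [← vdash_eq_bilin, ofWord_vdash_ofWord, preRepr_ofWord, toFreeAlgebra_ofWord,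
        Diword.vdash]
  exact LinearMap.congr_fun h f

theorem preRepr_wordVdash (a : List I) (f : FreeDialgebra k I) :
    preRepr x (wordVdash a f)
      = LinearMap.lTensor L (LinearMap.mulLeft k (algWord k a)) (preRepr x f) := by
  induction a with
  | nil => simp [wordVdash]
  | cons i a ih =>
    have h : preRepr x ∘ₗ bilin Diword.vdash (of k i)
        = LinearMap.lTensor L (LinearMap.mulLeft k (FreeAlgebra.ι k i)) ∘ₗ preRepr x :=
      linearMap_ext_ofWord fun u => by
        simp [← vdash_eq_bilin, of_eq_ofWord, ofWord_vdash_ofWord, preRepr_ofWord, Diword.vdash,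
          Diword.letters]
    have h' : preRepr x (wordVdash (i :: a) f)
        = LinearMap.lTensor L (LinearMap.mulLeft k (FreeAlgebra.ι k i))
          (preRepr x (wordVdash a f)) := LinearMap.congr_fun h (wordVdash a f)
    rw [h', ih, algWord_cons, LinearMap.mulLeft_mul, LinearMap.lTensor_comp, LinearMap.comp_apply]

theorem preRepr_dashvWord (f : FreeDialgebra k I) (b : List I) :
    preRepr x (dashvWord f b) = preRepr x f := by
  induction b generalizing f with
  | nil => rfl
  | cons i b ih =>
    have h : preRepr x ∘ₗ (bilin Diword.dashv).flip (of k i) = preRepr x :=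
      linearMap_ext_ofWord fun u => by
        simp [← dashv_eq_bilin, of_eq_ofWord, ofWord_dashv_ofWord, preRepr_ofWord, Diword.dashv]
    exact (ih (f ⊣ᵈ of k i)).trans (LinearMap.congr_fun h f)

theorem lTensor_mulLeft_mem (a : FreeAlgebra k I) {m : L ⊗[k] FreeAlgebra k I}
    (hm : m ∈ tensorIdeal br x) :
    LinearMap.lTensor L (LinearMap.mulLeft k a) m ∈ tensorIdeal br x :=
  map_tensorIdeal _ (fun v u hu => by
    simpa using tmul_mem_tensorIdeal v (mul_mem_commIdeal_left a hu)) hm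

/-- A left normed relation `z ⊢ xₜ` vanishes in every context around the center. -/
theorem preRepr_center_mem {z : FreeDialgebra k I} (hz : toFreeAlgebra z ∈ commIdeal br x)
    (t : I) (a b : List I) :
    preRepr x (dashvWord (wordVdash a (z ⊢ᵈ of k t)) b) ∈ tensorIdeal br x := by
  rw [preRepr_dashvWord, preRepr_wordVdash, of_eq_ofWord, preRepr_vdash_ofWord]
  exact lTensor_mulLeft_mem _ (tmul_mem_tensorIdeal _ (mul_mem_commIdeal_right _ hz))

/-- A relation vanishes in every context before the center. -/
theorem preRepr_before_mem {z : FreeDialgebra k I} (hz : toFreeAlgebra z ∈ commIdeal br x)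
    (a : List I) (d : Diword I) :
    preRepr x (wordVdash a (z ⊢ᵈ ofWord k d)) ∈ tensorIdeal br x := by
  rw [preRepr_wordVdash, preRepr_vdash_ofWord]
  exact lTensor_mulLeft_mem _ (tmul_mem_tensorIdeal _ (mul_mem_commIdeal_right _ hz))

/-- The relation for `(a, a)` is `-{a,a}`, and those for `(a, b)` and `(b, a)` add up to `-({a,b} +
{b,a})`. So `K` contains `L₀` without this being imposed. -/
theorem algForm_leibnizKernel_mem {z : L} (hz : z ∈ leibnizKernel br) :
    algForm x z ∈ commIdeal br x := by
  refine (Submodule.span_le (p := (commIdeal br x).comap (algForm x))).2 ?_ hz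
  rintro _ (⟨a, rfl⟩ | ⟨a, b, rfl⟩)
  · have := commRelation_mem br x a a
    rw [commRelation_apply, sub_self, zero_sub, neg_mem_iff] at this
    exact this
  · have := neg_mem (add_mem (commRelation_mem br x a b) (commRelation_mem br x b a))
    rw [commRelation_apply, commRelation_apply] at this
    simp only [SetLike.mem_coe, Submodule.mem_comap, map_add]
    convert this using 1
    abel

/-! ### Projections onto irreducible diwords. -/

variable [LinearOrder I] {I₀ : Set I}

/-- Apply `N` to the second factor and read the result back through `F`. Leaving `F` free serves
both right normed and left normed diwords. -/
theorem exists_tensor_projection (hbr : IsLeibniz br)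
    (hI₀ : Submodule.span k (x '' I₀) = leibnizKernel br) (F : I → List I → FreeDialgebra k I) :
    ∃ T : L ⊗[k] FreeAlgebra k I →ₗ[k] FreeDialgebra k I,
      (∀ m ∈ tensorIdeal br x, T m = 0) ∧
      ∀ t l, l.Pairwise (· ≤ ·) → (∀ i ∈ l, i ∉ I₀) → T (x t ⊗ₜ algWord k l) = F t l := by
  obtain ⟨N, hN, hfix⟩ := exists_pbw_projection hbr hI₀
  refine ⟨TensorProduct.lift (x.constr k fun t => (wordBasis k I).constr k (F t))
    ∘ₗ LinearMap.lTensor L N, fun m hm => ?_, fun t l hl hl₀ => ?_⟩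
  · refine map_tensorIdeal (Q := ⊥) _ (fun v u hu => ?_) hm
    simp [hN u hu]
  · have := (wordBasis k I).constr_basis k (F t) l
    rw [wordBasis_apply] at this
    simp [hfix l hl hl₀, this]

/-- A linear endomorphism of `D(X)` that kills the enveloping relations and fixes the
irreducible diwords. -/
theorem exists_projection (hbr : IsLeibniz br)
    (hI₀ : Submodule.span k (x '' I₀) = leibnizKernel br) :
    ∃ T : FreeDialgebra k I →ₗ[k] FreeDialgebra k I,
      (∀ f ∈ diIdeal k (envelopingRelations br x), T f = 0) ∧
      ∀ t l, l.Pairwise (· ≤ ·) → (∀ i ∈ l, i ∉ I₀) →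
        T (ofWord k ⟨[], t, l⟩) = ofWord k ⟨[], t, l⟩ := by
  obtain ⟨T, hT, hfix⟩ := exists_tensor_projection hbr hI₀ fun t l => ofWord k ⟨[], t, l⟩
  refine ⟨T ∘ₗ diRepr br x, fun f hf => hT _ (diRepr_mem hbr hf), fun t l hl hl₀ => ?_⟩
  simp [diRepr_ofWord, hfix t l hl hl₀]

/-- A linear endomorphism of `D(X)` that kills `f` as soon as its image in `L ⊗ k⟨X⟩` is trivial
and fixes the irreducible left normed diwords. -/
theorem exists_leftNormed_projection (hbr : IsLeibniz br)
    (hI₀ : Submodule.span k (x '' I₀) = leibnizKernel br) :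
    ∃ T : FreeDialgebra k I →ₗ[k] FreeDialgebra k I,
      (∀ f, preRepr x f ∈ tensorIdeal br x → T f = 0) ∧
      ∀ t l, l.Pairwise (· ≤ ·) → (∀ i ∈ l, i ∉ I₀) →
        T (ofWord k ⟨l, t, []⟩) = ofWord k ⟨l, t, []⟩ := by
  obtain ⟨T, hT, hfix⟩ := exists_tensor_projection hbr hI₀ fun t l => ofWord k ⟨l, t, []⟩
  refine ⟨T ∘ₗ preRepr x, fun f hf => hT _ hf, fun t l hl hl₀ => ?_⟩
  simp [preRepr_ofWord, hfix t l hl hl₀]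

end Representation

/-! ### The order on diwords -/

/-- Equal length rules out a proper prefix, for which appending on the right could reverse the
order. -/
theorem List.append_lt_append_of_length_eq {X : Type*} [LinearOrder X] {l l' : List X}
    (hl : l.length = l'.length) (h : l < l') (a b : List X) : a ++ l ++ b < a ++ l' ++ b := by
  rw [List.append_assoc, List.append_assoc]
  refine List.append_left_lt ?_
  induction l generalizing l' with
  | nil =>
    cases l' with
    | nil => exact absurd h (lt_irrefl _)
    | cons => simp at hl
  | cons p l ih =>
    cases l' with
    | nil => simp at hl
    | cons q l' =>
      simp only [List.length_cons, Nat.add_right_cancel_iff] at hl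
      rw [List.cons_append, List.cons_append, List.cons_lt_cons_iff]
      exact (List.cons_lt_cons_iff.1 h).imp id fun h => ⟨h.1, ih hl h.2⟩

namespace Diword

variable {X : Type*}

@[simp]
theorem length_mk (a b : List X) (t : X) :
    (⟨a, t, b⟩ : Diword X).length = a.length + b.length + 1 := by
  simp [length, letters]; omega

variable [LinearOrder X]

theorem lt_iff {u v : Diword X} : u < v ↔ u.length < v.length ∨ u.length = v.length ∧
    (u.pre.length < v.pre.length ∨ u.pre.length = v.pre.length ∧ u.letters < v.letters) := by
  change u.weight < v.weight ↔ _
  rw [weight, weight, Prod.Lex.toLex_lt_toLex, Prod.Lex.toLex_lt_toLex]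

theorem lt_of_length_lt {u v : Diword X} (h : u.length < v.length) : u < v :=
  lt_iff.2 (Or.inl h)

theorem length_le_of_le {u v : Diword X} (h : u ≤ v) : u.length ≤ v.length :=
  not_lt.1 fun hlt => (lt_of_length_lt hlt).not_ge h

theorem swap_post_lt (t : X) (a b : List X) {i j : X} (h : i < j) :
    (⟨[], t, a ++ i :: j :: b⟩ : Diword X) < ⟨[], t, a ++ j :: i :: b⟩ := by
  refine lt_iff.2 (Or.inr ⟨by simp, Or.inr ⟨rfl, ?_⟩⟩)
  have := List.append_lt_append_of_length_eq (l := [i, j]) (l' := [j, i]) rfl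
    (List.cons_lt_cons_iff.2 (Or.inl h)) (t :: a) b
  simpa [letters] using this

theorem swap_pre_lt (t : X) (a b : List X) {i j : X} (h : i < j) :
    (⟨a ++ i :: j :: b, t, []⟩ : Diword X) < ⟨a ++ j :: i :: b, t, []⟩ := by
  refine lt_iff.2 (Or.inr ⟨by simp, Or.inr ⟨by simp, ?_⟩⟩)
  have := List.append_lt_append_of_length_eq (l := [i, j]) (l' := [j, i]) rfl
    (List.cons_lt_cons_iff.2 (Or.inl h)) a (b ++ [t])
  simpa [letters] using this

theorem move_center_lt (a b : List X) (i j : X) :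
    (⟨a, i, j :: b⟩ : Diword X) < ⟨a ++ [j], i, b⟩ :=
  lt_iff.2 (Or.inr ⟨by simp; omega, Or.inl (by simp)⟩)

end Diword

namespace DiContext

open FreeDialgebra

variable {k X : Type*} [CommRing k]

/-- Normality is needed exactly here. The weight compares the numbers of letters before the center,
a comparison lost when the hole is not the center. If `s` is left (right) normed, that number is the
length minus one (zero) and cannot decide the order inside `s`. -/
theorem plugWord_lt [LinearOrder X] {s : FreeDialgebra k X} {c : DiContext X} (hc : c.IsNormal s)
    {u v : Diword X} (hu : u ∈ s.support) (hv : v ∈ s.support) (h : u < v) :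
    c.plugWord u < c.plugWord v := by
  have hlen : ∀ w : Diword X, w.length = w.letters.length := fun _ => rfl
  rw [Diword.lt_iff] at h ⊢
  cases c with
  | center a b =>
    have e : ∀ w : Diword X, (plugWord w (center a b)).letters = a ++ w.letters ++ b := by
      simp [plugWord, Diword.letters]
    have e' : ∀ w : Diword X, (plugWord w (center a b)).pre.length = a.length + w.pre.length := by
      simp [plugWord]
    simp only [hlen, e, e', List.length_append] at h ⊢
    rcases h with h | ⟨h, h' | ⟨h', h''⟩⟩
    · left; omega
    · right; exact ⟨by omega, Or.inl (by omega)⟩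
    · right
      exact ⟨by omega, Or.inr ⟨by omega, List.append_lt_append_of_length_eq h h'' a b⟩⟩
  | before a d =>
    have hn : ∀ w ∈ s.support, w.pre.length + 1 = w.letters.length := fun w hw => by
      simp [Diword.letters, hc w hw]
    have e : ∀ w : Diword X, (plugWord w (before a d)).letters
        = a ++ w.letters ++ d.letters := by
      simp [plugWord, Diword.letters]
    have e' : ∀ w : Diword X, (plugWord w (before a d)).pre.length
        = a.length + w.letters.length + d.pre.length := by
      simp [plugWord]; omega
    have hu' := hn u hu
    have hv' := hn v hv
    simp only [hlen, e, e', List.length_append] at h ⊢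
    rcases h with h | ⟨h, h' | ⟨h', h''⟩⟩
    · left; omega
    · omega
    · right
      exact ⟨by omega, Or.inr ⟨by omega, List.append_lt_append_of_length_eq h h'' _ _⟩⟩
  | after d b =>
    have e : ∀ w : Diword X, (plugWord w (after d b)).letters = d.letters ++ w.letters ++ b := by
      simp [plugWord, Diword.letters]
    have e' : ∀ w : Diword X, (plugWord w (after d b)).pre = d.pre := fun _ => rfl
    have hu' := hc u hu
    have hv' := hc v hv
    simp only [hlen, e, e', hu', hv', List.length_append, lt_irrefl, false_or, true_and] at h ⊢
    rcases h with h | ⟨h, h'⟩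
    · left; omega
    · exact Or.inr ⟨by omega, List.append_lt_append_of_length_eq h h' _ _⟩

/-- The substitution `s ↦ [asb]` as a linear map. -/
noncomputable def plugLinear (c : DiContext X) : FreeDialgebra k X →ₗ[k] FreeDialgebra k X :=
  Finsupp.lmapDomain k k fun u => c.plugWord u

@[simp]
theorem plugLinear_ofWord (c : DiContext X) (u : Diword X) :
    c.plugLinear (ofWord k u) = ofWord k (c.plugWord u) := by
  simp [plugLinear, ofWord]

theorem wordVdash_eq_plugLinear (a : List X) (f : FreeDialgebra k X) :
    wordVdash a f = (center a []).plugLinear f := by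
  induction a with
  | nil =>
    have : (center ([] : List X) []).plugLinear = LinearMap.id (R := k) :=
      linearMap_ext_ofWord fun u => by simp [plugWord]
    rw [this]; rfl
  | cons i a ih =>
    have : bilin Diword.vdash (of k i) ∘ₗ (center a []).plugLinear
        = (center (i :: a) []).plugLinear := linearMap_ext_ofWord fun u => by
      simp [← vdash_eq_bilin, of_eq_ofWord, ofWord_vdash_ofWord, plugWord, Diword.vdash,
        Diword.letters]
    rw [← this, LinearMap.comp_apply, ← ih]
    rfl

theorem dashvWord_eq_plugLinear (f : FreeDialgebra k X) (b : List X) :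
    dashvWord f b = (center [] b).plugLinear f := by
  induction b generalizing f with
  | nil =>
    have : (center ([] : List X) []).plugLinear = LinearMap.id (R := k) :=
      linearMap_ext_ofWord fun u => by simp [plugWord]
    rw [this]; rfl
  | cons i b ih =>
    have : (center [] b).plugLinear ∘ₗ (bilin Diword.dashv).flip (of k i)
        = (center [] (i :: b)).plugLinear := linearMap_ext_ofWord fun u => by
      simp [← dashv_eq_bilin, of_eq_ofWord, ofWord_dashv_ofWord, plugWord, Diword.dashv,
        Diword.letters]
    rw [← this, LinearMap.comp_apply]
    exact ih (f ⊣ᵈ of k i)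

theorem plug_eq_plugLinear (s : FreeDialgebra k X) (c : DiContext X) :
    c.plug s = c.plugLinear s := by
  cases c with
  | center a b =>
    rw [plug, dashvWord_eq_plugLinear, wordVdash_eq_plugLinear, ← LinearMap.comp_apply]
    refine LinearMap.congr_fun (linearMap_ext_ofWord fun u => ?_) s
    simp [plugWord]
  | before a d =>
    have : (center a []).plugLinear ∘ₗ (bilin Diword.vdash).flip (ofWord k d)
        = (before a d).plugLinear := linearMap_ext_ofWord fun u => by
      simp [← vdash_eq_bilin, ofWord_vdash_ofWord, plugWord, Diword.vdash]
    rw [plug, wordVdash_eq_plugLinear, ← this]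
    rfl
  | after d b =>
    have : (center [] b).plugLinear ∘ₗ (bilin Diword.dashv) (ofWord k d)
        = (after d b).plugLinear := linearMap_ext_ofWord fun u => by
      simp [← dashv_eq_bilin, ofWord_dashv_ofWord, plugWord, Diword.dashv]
    rw [plug, dashvWord_eq_plugLinear, ← this]
    rfl

theorem exists_of_mem_support_plug {s : FreeDialgebra k X} {c : DiContext X} {w : Diword X}
    (hw : w ∈ (c.plug s).support) : ∃ u ∈ s.support, c.plugWord u = w := by
  classical
  rw [plug_eq_plugLinear] at hw
  simpa using Finsupp.mapDomain_support hw

end DiContext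

/-! ### Leading diwords -/

namespace FreeDialgebra

variable {k X : Type*} [CommRing k]

variable (k) in
/-- The linear combinations of diwords that satisfy `P`. -/
noncomputable def wordSpan (P : Diword X → Prop) : Submodule k (FreeDialgebra k X) :=
  Finsupp.supported k k {v | P v}

theorem ofWord_mem_wordSpan {P : Diword X → Prop} {u : Diword X} (h : P u) :
    ofWord k u ∈ wordSpan k P := Finsupp.single_mem_supported k 1 h

theorem mem_wordSpan {P : Diword X → Prop} {f : FreeDialgebra k X} :
    f ∈ wordSpan k P ↔ ∀ u ∈ f.support, P u := Iff.rfl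

theorem wordSpan_le {P : Diword X → Prop} {Q : Submodule k (FreeDialgebra k X)}
    (h : ∀ u, P u → ofWord k u ∈ Q) : wordSpan k P ≤ Q := by
  rw [wordSpan, Finsupp.supported_eq_span_single, Submodule.span_le]
  rintro _ ⟨u, hu, rfl⟩
  exact h u hu

variable [LinearOrder X]

theorem isLeading_of_sub_mem [Nontrivial k] {f : FreeDialgebra k X} {u : Diword X}
    (h : f - ofWord k u ∈ wordSpan k (· < u)) : IsLeading f u ∧ f u = 1 := by
  have hu : f u = 1 := by
    by_contra hne
    refine lt_irrefl u (mem_wordSpan.1 h u ?_)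
    simpa [ofWord, sub_eq_zero] using hne
  refine ⟨⟨by simp [hu], fun v hv => ?_⟩, hu⟩
  by_cases hvu : v = u
  · exact hvu.le
  · refine (mem_wordSpan.1 h v ?_).le
    simpa [ofWord, Finsupp.single_apply, Ne.symm hvu] using hv

/-- A normal `s`-diword of a monic `s` is again monic with leading diword `[as̄b]`. -/
theorem plug_sub_mem {f : FreeDialgebra k X} {u : Diword X} (hu : IsLeading f u) (h1 : f u = 1)
    {c : DiContext X} (hc : c.IsNormal f) :
    c.plug f - ofWord k (c.plugWord u) ∈ wordSpan k (· < c.plugWord u) := by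
  classical
  rw [DiContext.plug_eq_plugLinear, ← DiContext.plugLinear_ofWord, ← map_sub, mem_wordSpan]
  intro w hw
  obtain ⟨v, hv, rfl⟩ : ∃ v ∈ (f - ofWord k u).support, c.plugWord v = w := by
    simpa only [Finset.mem_image] using Finsupp.mapDomain_support hw
  have hvu : v ≠ u := by
    rintro rfl
    simp [ofWord, h1] at hv
  have hvf : v ∈ f.support := by
    simpa [ofWord, Finsupp.single_apply, hvu.symm] using hv
  exact DiContext.plugWord_lt hc hvf hu.1 (lt_of_le_of_ne (hu.2 hvf) hvu)

theorem normalSpan_mono {S : Set (FreeDialgebra k X)} {P P' : Diword X → Prop}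
    {N N' : FreeDialgebra k X → Prop} (hP : ∀ u, P u → P' u) (hN : ∀ f, N f → N' f) :
    normalSpan S P N ≤ normalSpan S P' N' := by
  refine Submodule.span_mono ?_
  rintro _ ⟨s, hs, u, hu, c, hc, hPc, hNs, hNc, rfl⟩
  exact ⟨s, hs, u, hu, c, hc, hP _ hPc, hN _ hNs, hN _ hNc, rfl⟩

end FreeDialgebra

/-! ### The ideal generated by the set `S` -/

section PBWIdeal

open FreeDialgebra

variable {k L I : Type*} [CommRing k] [AddCommGroup L] [Module k L]

theorem subset_diIdeal (S : Set (FreeDialgebra k I)) {f : FreeDialgebra k I} (hf : f ∈ S) :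
    f ∈ diIdeal k S :=
  Submodule.mem_sInf.2 fun _ hJ => hJ.1 hf

theorem diIdeal_le {S : Set (FreeDialgebra k I)} {J : Submodule k (FreeDialgebra k I)}
    [hJ : IsDiIdeal J] (h : ∀ f ∈ S, f ∈ J) : diIdeal k S ≤ J :=
  sInf_le ⟨h, hJ⟩

@[simp]
theorem linearForm_basis (x : Module.Basis I k L) (i : I) : linearForm x (x i) = of k i :=
  x.constr_basis k _ i

variable {br : L →ₗ[k] L →ₗ[k] L} {x : Module.Basis I k L}

variable (br x) in
/-- `y ⊣ z - z ⊢ y - {y,z}` as a bilinear map. -/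
noncomputable def diRelation : L →ₗ[k] L →ₗ[k] FreeDialgebra k I :=
  LinearMap.mk₂ k (fun y z => linearForm x y ⊣ᵈ linearForm x z - linearForm x z ⊢ᵈ linearForm x y
      - linearForm x (br y z))
    (fun y y' z => by
      simp only [map_add, LinearMap.add_apply, dashv_eq_bilin, vdash_eq_bilin]; abel)
    (fun r y z => by
      simp only [map_smul, LinearMap.smul_apply, dashv_eq_bilin, vdash_eq_bilin, smul_sub])
    (fun y z z' => by
      simp only [map_add, LinearMap.add_apply, dashv_eq_bilin, vdash_eq_bilin]; abel)
    (fun r y z => by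
      simp only [map_smul, LinearMap.smul_apply, dashv_eq_bilin, vdash_eq_bilin, smul_sub])

theorem diRelation_apply (y z : L) : diRelation br x y z
    = linearForm x y ⊣ᵈ linearForm x z - linearForm x z ⊢ᵈ linearForm x y
      - linearForm x (br y z) := rfl

theorem diRelation_mem (y z : L) :
    diRelation br x y z ∈ diIdeal k (envelopingRelations br x) := by
  refine x.map_mem_of_forall ((diRelation br x).flip z) (fun i => ?_) y
  refine x.map_mem_of_forall (diRelation br x (x i)) (fun j => ?_) z
  exact subset_diIdeal _ ⟨i, j, by simp [diRelation_apply]⟩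

theorem dashv_sub' (a b c : FreeDialgebra k I) : a ⊣ᵈ (b - c) = a ⊣ᵈ b - a ⊣ᵈ c := by
  simp [dashv_eq_bilin]

theorem dashv_add' (a b c : FreeDialgebra k I) : a ⊣ᵈ (b + c) = a ⊣ᵈ b + a ⊣ᵈ c := by
  simp [dashv_eq_bilin]

theorem sub_vdash' (a b c : FreeDialgebra k I) : (a - b) ⊢ᵈ c = a ⊢ᵈ c - b ⊢ᵈ c := by
  simp [vdash_eq_bilin]

theorem add_vdash' (a b c : FreeDialgebra k I) : (a + b) ⊢ᵈ c = a ⊢ᵈ c + b ⊢ᵈ c := by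
  simp [vdash_eq_bilin]

theorem dashv_diRelation (t : FreeDialgebra k I) (y z : L) : t ⊣ᵈ diRelation br x y z
    = t ⊣ᵈ linearForm x y ⊣ᵈ linearForm x z - t ⊣ᵈ linearForm x z ⊣ᵈ linearForm x y
      - t ⊣ᵈ linearForm x (br y z) := by
  rw [diRelation_apply, dashv_sub', dashv_sub', Dialgebra.dashv_vdash (k := k),
    Dialgebra.dashv_assoc (k := k) t (linearForm x y)]

theorem diRelation_vdash (t : FreeDialgebra k I) (y z : L) : diRelation br x y z ⊢ᵈ t
    = linearForm x y ⊢ᵈ linearForm x z ⊢ᵈ t - linearForm x z ⊢ᵈ linearForm x y ⊢ᵈ t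
      - linearForm x (br y z) ⊢ᵈ t := by
  rw [diRelation_apply, sub_vdash', sub_vdash', Dialgebra.dashv_vdash' (k := k),
    Dialgebra.vdash_assoc (k := k) (linearForm x y)]

/-- To the right of `t ⊣` the two products agree, so `a ⊣ a - a ⊢ a` disappears and the relation
leaves `-(t ⊣ {a,a})`; polarised sums work alike. -/
theorem dashv_leibnizKernel_mem (t : FreeDialgebra k I) {z : L} (hz : z ∈ leibnizKernel br) :
    t ⊣ᵈ linearForm x z ∈ diIdeal k (envelopingRelations br x) := by
  refine (Submodule.span_le (p := (diIdeal k (envelopingRelations br x)).comap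
    (bilin Diword.dashv t ∘ₗ linearForm x))).2 ?_ hz
  have h : ∀ a b, t ⊣ᵈ diRelation br x a b ∈ diIdeal k (envelopingRelations br x) :=
    fun a b => IsDiIdeal.dashv_left t (diRelation_mem a b)
  rintro _ (⟨a, rfl⟩ | ⟨a, b, rfl⟩)
  · have := h a a
    rw [dashv_diRelation, sub_self, zero_sub, neg_mem_iff] at this
    exact this
  · have := neg_mem (add_mem (h a b) (h b a))
    rw [dashv_diRelation, dashv_diRelation] at this
    change t ⊣ᵈ linearForm x (br a b + br b a) ∈ diIdeal k (envelopingRelations br x)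
    rw [map_add, dashv_add']
    convert this using 1
    abel

theorem leibnizKernel_vdash_mem (t : FreeDialgebra k I) {z : L} (hz : z ∈ leibnizKernel br) :
    linearForm x z ⊢ᵈ t ∈ diIdeal k (envelopingRelations br x) := by
  refine (Submodule.span_le (p := (diIdeal k (envelopingRelations br x)).comap
    ((bilin Diword.vdash).flip t ∘ₗ linearForm x))).2 ?_ hz
  have h : ∀ a b, diRelation br x a b ⊢ᵈ t ∈ diIdeal k (envelopingRelations br x) :=
    fun a b => IsDiIdeal.vdash_right t (diRelation_mem a b)
  rintro _ (⟨a, rfl⟩ | ⟨a, b, rfl⟩)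
  · have := h a a
    rw [diRelation_vdash, sub_self, zero_sub, neg_mem_iff] at this
    exact this
  · have := neg_mem (add_mem (h a b) (h b a))
    rw [diRelation_vdash, diRelation_vdash] at this
    change linearForm x (br a b + br b a) ⊢ᵈ t ∈ diIdeal k (envelopingRelations br x)
    rw [map_add, add_vdash']
    convert this using 1
    abel

theorem wordVdash_mem (J : Submodule k (FreeDialgebra k I)) [IsDiIdeal J] (a : List I)
    {f : FreeDialgebra k I} (hf : f ∈ J) : wordVdash a f ∈ J := by
  induction a with
  | nil => exact hf
  | cons i a ih => exact IsDiIdeal.vdash_left _ ih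

theorem dashvWord_mem (J : Submodule k (FreeDialgebra k I)) [IsDiIdeal J] (b : List I)
    {f : FreeDialgebra k I} (hf : f ∈ J) : dashvWord f b ∈ J := by
  induction b generalizing f with
  | nil => exact hf
  | cons i b ih => exact ih (IsDiIdeal.dashv_right _ hf)

theorem plug_mem (J : Submodule k (FreeDialgebra k I)) [IsDiIdeal J] (c : DiContext I)
    {f : FreeDialgebra k I} (hf : f ∈ J) : c.plug f ∈ J := by
  cases c with
  | center a b => exact dashvWord_mem J b (wordVdash_mem J a hf)
  | before a d => exact wordVdash_mem J a (IsDiIdeal.vdash_right _ hf)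
  | after d b => exact dashvWord_mem J b (IsDiIdeal.dashv_left _ hf)

variable [LinearOrder I] {I₀ : Set I}

/-- The first family is the negated defining relation; the second and fourth are its products with
`⊢ xₜ` and `xₜ ⊣`; the third and fifth come from `L₀`. -/
theorem pbwSet_subset_diIdeal (hI₀ : Submodule.span k (x '' I₀) = leibnizKernel br)
    {f : FreeDialgebra k I} (hf : f ∈ pbwSet br x I₀) :
    f ∈ diIdeal k (envelopingRelations br x) := by
  have hker : ∀ p ∈ I₀, x p ∈ leibnizKernel br := fun p hp =>
    hI₀ ▸ Submodule.subset_span ⟨p, hp, rfl⟩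
  rcases hf with (((⟨i, j, rfl⟩ | ⟨i, j, t, -, rfl⟩) | ⟨i, hi, t, rfl⟩) | ⟨i, j, t, -, rfl⟩) |
    ⟨i, hi, t, rfl⟩
  · convert neg_mem (diRelation_mem (br := br) (x := x) (x i) (x j)) using 1
    rw [diRelation_apply, linearForm_basis, linearForm_basis]
    abel
  · convert neg_mem (IsDiIdeal.vdash_right (of k t)
      (diRelation_mem (br := br) (x := x) (x i) (x j))) using 1
    rw [diRelation_vdash, linearForm_basis, linearForm_basis]
    abel
  · simpa using leibnizKernel_vdash_mem (x := x) (of k t) (hker i hi)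
  · convert neg_mem (IsDiIdeal.dashv_left (of k t)
      (diRelation_mem (br := br) (x := x) (x i) (x j))) using 1
    rw [dashv_diRelation, linearForm_basis, linearForm_basis]
    abel
  · simpa using dashv_leibnizKernel_mem (x := x) (of k t) (hker i hi)

theorem diIdeal_pbwSet (hI₀ : Submodule.span k (x '' I₀) = leibnizKernel br) :
    diIdeal k (envelopingRelations br x) = diIdeal k (pbwSet br x I₀) := by
  refine le_antisymm (diIdeal_le ?_) (diIdeal_le fun f hf => pbwSet_subset_diIdeal hI₀ hf)
  rintro _ ⟨i, j, rfl⟩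
  rw [← neg_mem_iff]
  exact subset_diIdeal _ (Or.inl (Or.inl (Or.inl (Or.inl ⟨i, j, by abel⟩))))

theorem normalSpan_le_diIdeal (hI₀ : Submodule.span k (x '' I₀) = leibnizKernel br)
    (P : Diword I → Prop) (N : FreeDialgebra k I → Prop) :
    normalSpan (pbwSet br x I₀) P N ≤ diIdeal k (envelopingRelations br x) := by
  refine Submodule.span_le.2 ?_
  rintro _ ⟨s, hs, u, -, c, -, -, -, -, rfl⟩
  exact plug_mem _ c (pbwSet_subset_diIdeal hI₀ hs)

end PBWIdeal

/-! ### Leading diwords of the elements of `S` -/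

section PBWLeading

open FreeDialgebra

variable {k L I : Type*} [CommRing k] [AddCommGroup L] [Module k L]
  {br : L →ₗ[k] L →ₗ[k] L} {x : Module.Basis I k L}

theorem linearForm_mem {Q : Submodule k (FreeDialgebra k I)}
    (F : FreeDialgebra k I →ₗ[k] FreeDialgebra k I) (h : ∀ i, F (of k i) ∈ Q) (z : L) :
    F (linearForm x z) ∈ Q :=
  x.map_mem_of_forall (F ∘ₗ linearForm x) (by simpa using h) z

theorem of_dashv_of (t i : I) : of k t ⊣ᵈ of k i = ofWord k ⟨[], t, [i]⟩ :=
  ofWord_dashv_ofWord _ _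

theorem of_vdash_of (t i : I) : of k t ⊢ᵈ of k i = ofWord k ⟨[t], i, []⟩ :=
  ofWord_vdash_ofWord _ _

theorem of_dashv_of_dashv_of (t i j : I) :
    of k t ⊣ᵈ of k i ⊣ᵈ of k j = ofWord k ⟨[], t, [i, j]⟩ := by
  rw [of_dashv_of]; exact ofWord_dashv_ofWord _ _

theorem of_vdash_of_vdash_of (t i j : I) :
    of k t ⊢ᵈ of k i ⊢ᵈ of k j = ofWord k ⟨[t, i], j, []⟩ := by
  rw [of_vdash_of]; exact ofWord_vdash_ofWord _ _

theorem dashv_linearForm_mem {Q : Submodule k (FreeDialgebra k I)}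
    (F : FreeDialgebra k I →ₗ[k] FreeDialgebra k I) (t : I)
    (h : ∀ i, F (ofWord k ⟨[], t, [i]⟩) ∈ Q) (z : L) :
    F (of k t ⊣ᵈ linearForm x z) ∈ Q :=
  linearForm_mem (F ∘ₗ bilin Diword.dashv (of k t))
    (fun i => by simpa [← of_dashv_of, dashv_eq_bilin] using h i) z

theorem linearForm_vdash_mem {Q : Submodule k (FreeDialgebra k I)}
    (F : FreeDialgebra k I →ₗ[k] FreeDialgebra k I) (t : I)
    (h : ∀ i, F (ofWord k ⟨[i], t, []⟩) ∈ Q) (z : L) :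
    F (linearForm x z ⊢ᵈ of k t) ∈ Q :=
  linearForm_mem (F ∘ₗ (bilin Diword.vdash).flip (of k t))
    (fun i => by simpa [← of_vdash_of, vdash_eq_bilin] using h i) z

theorem linearForm_mem_wordSpan {P : Diword I → Prop} (h : ∀ i, P ⟨[], i, []⟩) (z : L) :
    linearForm x z ∈ wordSpan k P :=
  x.map_mem_of_forall (linearForm x)
    (fun i => by rw [linearForm_basis]; exact ofWord_mem_wordSpan (h i)) z

theorem dashv_linearForm_mem_wordSpan {P : Diword I → Prop} {t : I} (h : ∀ i, P ⟨[], t, [i]⟩)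
    (z : L) : of k t ⊣ᵈ linearForm x z ∈ wordSpan k P :=
  dashv_linearForm_mem (Q := wordSpan k P) LinearMap.id t
    (fun i => by rw [LinearMap.id_apply]; exact ofWord_mem_wordSpan (h i)) z

theorem linearForm_vdash_mem_wordSpan {P : Diword I → Prop} {t : I} (h : ∀ i, P ⟨[i], t, []⟩)
    (z : L) : linearForm x z ⊢ᵈ of k t ∈ wordSpan k P :=
  linearForm_vdash_mem (Q := wordSpan k P) LinearMap.id t
    (fun i => by rw [LinearMap.id_apply]; exact ofWord_mem_wordSpan (h i)) z

theorem isLeftNormed_ofWord (a : List I) (t : I) : IsLeftNormed (ofWord k ⟨a, t, []⟩) :=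
  mem_wordSpan (P := fun u => u.post = []) |>.1 (ofWord_mem_wordSpan rfl)

theorem isRightNormed_ofWord (t : I) (b : List I) : IsRightNormed (ofWord k ⟨[], t, b⟩) :=
  mem_wordSpan (P := fun u => u.pre = []) |>.1 (ofWord_mem_wordSpan rfl)

theorem left_isLeftNormed (i j t : I) (z : L) :
    IsLeftNormed (of k j ⊢ᵈ of k i ⊢ᵈ of k t - of k i ⊢ᵈ of k j ⊢ᵈ of k t
      + linearForm x z ⊢ᵈ of k t) := by
  rw [of_vdash_of_vdash_of, of_vdash_of_vdash_of]
  exact (mem_wordSpan (P := fun u => u.post = [])).1 (add_mem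
    (sub_mem (ofWord_mem_wordSpan rfl) (ofWord_mem_wordSpan rfl))
    (linearForm_vdash_mem_wordSpan (fun m => rfl) _))

theorem right_isRightNormed (i j t : I) (z : L) :
    IsRightNormed (of k t ⊣ᵈ of k j ⊣ᵈ of k i - of k t ⊣ᵈ of k i ⊣ᵈ of k j
      + of k t ⊣ᵈ linearForm x z) := by
  rw [of_dashv_of_dashv_of, of_dashv_of_dashv_of]
  exact (mem_wordSpan (P := fun u => u.pre = [])).1 (add_mem
    (sub_mem (ofWord_mem_wordSpan rfl) (ofWord_mem_wordSpan rfl))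
    (dashv_linearForm_mem_wordSpan (fun m => rfl) _))

variable [LinearOrder I]

theorem mixed_sub_mem (i j : I) :
    of k j ⊢ᵈ of k i - of k i ⊣ᵈ of k j + linearForm x (br (x i) (x j)) - ofWord k ⟨[j], i, []⟩
      ∈ wordSpan k (· < ⟨[j], i, []⟩) := by
  rw [of_dashv_of, of_vdash_of, add_sub_right_comm, sub_sub_cancel_left]
  refine add_mem (neg_mem (ofWord_mem_wordSpan (Diword.move_center_lt [] [] i j)))
    (linearForm_mem_wordSpan (fun m => ?_) _)
  exact Diword.lt_of_length_lt (by simp)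

theorem left_sub_mem {i j : I} (h : i < j) (t : I) :
    of k j ⊢ᵈ of k i ⊢ᵈ of k t - of k i ⊢ᵈ of k j ⊢ᵈ of k t
      + linearForm x (br (x i) (x j)) ⊢ᵈ of k t - ofWord k ⟨[j, i], t, []⟩
      ∈ wordSpan k (· < ⟨[j, i], t, []⟩) := by
  rw [of_vdash_of_vdash_of, of_vdash_of_vdash_of, add_sub_right_comm, sub_sub_cancel_left]
  refine add_mem (neg_mem (ofWord_mem_wordSpan (Diword.swap_pre_lt t [] [] h)))
    (linearForm_vdash_mem_wordSpan (fun m => ?_) _)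
  exact Diword.lt_of_length_lt (by simp)

theorem right_sub_mem {i j : I} (h : i < j) (t : I) :
    of k t ⊣ᵈ of k j ⊣ᵈ of k i - of k t ⊣ᵈ of k i ⊣ᵈ of k j
      + of k t ⊣ᵈ linearForm x (br (x i) (x j)) - ofWord k ⟨[], t, [j, i]⟩
      ∈ wordSpan k (· < ⟨[], t, [j, i]⟩) := by
  rw [of_dashv_of_dashv_of, of_dashv_of_dashv_of, add_sub_right_comm, sub_sub_cancel_left]
  refine add_mem (neg_mem (ofWord_mem_wordSpan (Diword.swap_post_lt t [] [] h)))
    (dashv_linearForm_mem_wordSpan (fun m => ?_) _)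
  exact Diword.lt_of_length_lt (by simp)

variable [Nontrivial k]

theorem isLeading_ofWord (u : Diword I) : IsLeading (ofWord k u) u :=
  (isLeading_of_sub_mem (by simp)).1

theorem pbwSet_exists_leading {I₀ : Set I} {f : FreeDialgebra k I} (hf : f ∈ pbwSet br x I₀) :
    ∃ u, IsLeading f u ∧ f u = 1 := by
  rcases hf with (((⟨i, j, rfl⟩ | ⟨i, j, t, h, rfl⟩) | ⟨i, hi, t, rfl⟩) | ⟨i, j, t, h, rfl⟩) |
    ⟨i, hi, t, rfl⟩
  · exact ⟨_, isLeading_of_sub_mem (mixed_sub_mem i j)⟩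
  · exact ⟨_, isLeading_of_sub_mem (left_sub_mem h t)⟩
  · exact ⟨_, isLeading_of_sub_mem (u := ⟨[i], t, []⟩) (by simp [of_vdash_of])⟩
  · exact ⟨_, isLeading_of_sub_mem (right_sub_mem h t)⟩
  · exact ⟨_, isLeading_of_sub_mem (u := ⟨[], t, [i]⟩) (by simp [of_dashv_of])⟩

theorem pbwSet_leading_coeff {I₀ : Set I} {f : FreeDialgebra k I} (hf : f ∈ pbwSet br x I₀)
    {u : Diword I} (hu : IsLeading f u) : f u = 1 := by
  obtain ⟨v, hv, h⟩ := pbwSet_exists_leading hf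
  rwa [hu.unique hv]

/-- A left normed element of `S` is of the form `z ⊢ xₜ`, where `z` is a relation of the
associative enveloping algebra, and is not right normed. -/
theorem exists_of_isLeftNormed {I₀ : Set I}
    (hI₀ : Submodule.span k (x '' I₀) = leibnizKernel br) {f : FreeDialgebra k I}
    (hf : f ∈ pbwSet br x I₀) (hn : IsLeftNormed f) :
    (∃ z t, f = z ⊢ᵈ of k t ∧ toFreeAlgebra z ∈ commIdeal br x) ∧ ¬ IsRightNormed f := by
  rcases hf with (((⟨i, j, rfl⟩ | ⟨i, j, t, h, rfl⟩) | ⟨i, hi, t, rfl⟩) | ⟨i, j, t, h, rfl⟩) |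
    ⟨i, hi, t, rfl⟩
  · exfalso
    -- The bracket term has degree one and cannot cancel `xᵢ ⊣ xⱼ`, whose center is not its last
    -- letter.
    have hlf : linearForm x (br (x i) (x j)) ∈ wordSpan k (fun u => u.length = 1) :=
      linearForm_mem_wordSpan (fun m => by simp) _
    have hc : linearForm x (br (x i) (x j)) ⟨[], i, [j]⟩ = 0 := by
      by_contra hne
      simpa using mem_wordSpan.1 hlf ⟨[], i, [j]⟩ (by simpa using hne)
    have := hn ⟨[], i, [j]⟩ (by simp [of_vdash_of, of_dashv_of, ofWord, hc])
    simp at this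
  · refine ⟨⟨of k j ⊢ᵈ of k i - of k i ⊢ᵈ of k j + linearForm x (br (x i) (x j)), t, ?_, ?_⟩, ?_⟩
    · rw [add_vdash', sub_vdash']
    · have := neg_mem (commRelation_mem br x (x i) (x j))
      rw [commRelation_apply, algForm_basis, algForm_basis] at this
      rw [map_add, map_sub, toFreeAlgebra_vdash, toFreeAlgebra_vdash, toFreeAlgebra_of,
        toFreeAlgebra_of, toFreeAlgebra_linearForm]
      convert this using 1
      abel
    · intro hr
      simpa using hr _ (isLeading_of_sub_mem (left_sub_mem h t)).1.1
  · refine ⟨⟨of k i, t, rfl, ?_⟩, ?_⟩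
    · rw [toFreeAlgebra_of, ← algForm_basis x]
      exact algForm_leibnizKernel_mem (hI₀ ▸ Submodule.subset_span ⟨i, hi, rfl⟩)
    · intro hr
      rw [of_vdash_of] at hr
      simpa using hr _ (isLeading_ofWord _).1
  · simpa using hn _ (isLeading_of_sub_mem (right_sub_mem h t)).1.1
  · rw [of_dashv_of] at hn
    simpa using hn _ (isLeading_ofWord _).1

end PBWLeading

/-! ### Reduction of diwords modulo `S` -/

section Reduction

open FreeDialgebra

variable {k L I : Type*} [CommRing k] [AddCommGroup L] [Module k L]

/-- If a linear map fixes `R` pointwise and kills `M` and `f`, then `f ∈ R ⊔ M` lies in `M`. -/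
theorem mem_of_mem_sup_of_projection {E : Type*} [AddCommGroup E] [Module k E]
    {R M : Submodule k E} (T : E →ₗ[k] E) (hR : ∀ r ∈ R, T r = r) (hM : ∀ m ∈ M, T m = 0) {f : E}
    (hT : T f = 0) (hf : f ∈ R ⊔ M) : f ∈ M := by
  obtain ⟨r, hr, m, hm, rfl⟩ := Submodule.mem_sup.1 hf
  rw [map_add, hR r hr, hM m hm, add_zero] at hT
  rwa [hT, zero_add]

theorem ofWord_plugWord_mem {Q : Submodule k (FreeDialgebra k I)} {s : FreeDialgebra k I}
    {u : Diword I} {c : DiContext I} (hs : c.plug s ∈ Q)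
    (hrest : c.plugLinear (s - ofWord k u) ∈ Q) : ofWord k (c.plugWord u) ∈ Q := by
  rw [map_sub, ← DiContext.plug_eq_plugLinear, DiContext.plugLinear_ofWord] at hrest
  simpa using sub_mem hs hrest

/-- The letter in front of the rewritten block serves as the center `t'` of the relation. It is the
true center `t` when `a` is empty; otherwise it is the last letter of `a`, and the relation sits
after the center, which is normal since it is right normed. -/
theorem exists_right_context (t : I) (a b : List I) : ∃ (c : DiContext I) (t' : I),
    (∀ s : FreeDialgebra k I, IsRightNormed s → c.IsNormal s ∧ IsRightNormed (c.plug s)) ∧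
    ∀ l, c.plugWord ⟨[], t', l⟩ = ⟨[], t, a ++ l ++ b⟩ := by
  rcases List.eq_nil_or_concat a with rfl | ⟨a, t', rfl⟩
  · refine ⟨.center [] b, t, fun s hs => ⟨trivial, fun w hw => ?_⟩, fun l => by
      simp [DiContext.plugWord]⟩
    obtain ⟨u, hu, rfl⟩ := DiContext.exists_of_mem_support_plug hw
    simpa [DiContext.plugWord] using hs u hu
  · refine ⟨.after ⟨[], t, a⟩ b, t', fun s hs => ⟨hs, fun w hw => ?_⟩, fun l => by
      simp [DiContext.plugWord, Diword.letters]⟩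
    obtain ⟨u, hu, rfl⟩ := DiContext.exists_of_mem_support_plug hw
    rfl

theorem exists_left_context (t : I) (a b : List I) : ∃ (c : DiContext I) (t' : I),
    (∀ s : FreeDialgebra k I, IsLeftNormed s → c.IsNormal s ∧ IsLeftNormed (c.plug s)) ∧
    ∀ l, c.plugWord ⟨l, t', []⟩ = ⟨a ++ l ++ b, t, []⟩ := by
  cases b with
  | nil =>
    refine ⟨.center a [], t, fun s hs => ⟨trivial, fun w hw => ?_⟩, fun l => by
      simp [DiContext.plugWord]⟩
    obtain ⟨u, hu, rfl⟩ := DiContext.exists_of_mem_support_plug hw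
    simpa [DiContext.plugWord] using hs u hu
  | cons t' b =>
    refine ⟨.before a ⟨b, t, []⟩, t', fun s hs => ⟨hs, fun w hw => ?_⟩, fun l => by
      simp [DiContext.plugWord, Diword.letters]⟩
    obtain ⟨u, hu, rfl⟩ := DiContext.exists_of_mem_support_plug hw
    rfl

theorem mem_wordSpan_degree (f : FreeDialgebra k I) :
    f ∈ wordSpan k (fun u => u.length ≤ degree f) :=
  mem_wordSpan.2 fun _ hu => Finset.le_sup (f := Diword.length) hu

theorem isRightNormed_of_dashv (t : I) (f : FreeDialgebra k I) : IsRightNormed (of k t ⊣ᵈ f) :=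
  (mem_wordSpan (P := fun u => u.pre = [])).1
    (map_mem_of_ofWord (bilin Diword.dashv (of k t)) (fun u => by
      rw [← dashv_eq_bilin, of_eq_ofWord, ofWord_dashv_ofWord]
      exact ofWord_mem_wordSpan rfl) f)

theorem isLeftNormed_vdash_of (f : FreeDialgebra k I) (t : I) : IsLeftNormed (f ⊢ᵈ of k t) :=
  (mem_wordSpan (P := fun u => u.post = [])).1
    (map_mem_of_ofWord ((bilin Diword.vdash).flip (of k t)) (fun u => by
      rw [LinearMap.flip_apply, ← vdash_eq_bilin, of_eq_ofWord, ofWord_vdash_ofWord]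
      exact ofWord_mem_wordSpan rfl) f)

theorem dashvWord_of (t : I) (l : List I) : dashvWord (of k t) l = ofWord k ⟨[], t, l⟩ := by
  rw [DiContext.dashvWord_eq_plugLinear, of_eq_ofWord, DiContext.plugLinear_ofWord]
  simp [DiContext.plugWord]

theorem toEnveloping_br {br : L →ₗ[k] L →ₗ[k] L} {x : Module.Basis I k L} (a b : L) :
    toEnveloping br x (br a b)
      = toEnveloping br x a ⊣ᵈ toEnveloping br x b
        - toEnveloping br x b ⊢ᵈ toEnveloping br x a := by
  have h := diRelation_mem (br := br) (x := x) a b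
  rw [diRelation_apply] at h
  exact ((Submodule.Quotient.eq _).2 h).symm

theorem mem_sup_normalSpan_mono [LinearOrder I] {S : Set (FreeDialgebra k I)}
    {P P' : Diword I → Prop} {N N' : FreeDialgebra k I → Prop}
    {R : Submodule k (FreeDialgebra k I)} (hP : ∀ u, P u → P' u) (hN : ∀ f, N f → N' f)
    {f : FreeDialgebra k I} (hf : f ∈ R ⊔ normalSpan S P N) : f ∈ R ⊔ normalSpan S P' N' := by
  have h : R ⊔ normalSpan S P N ≤ R ⊔ normalSpan S P' N' :=
    sup_le_sup_left (normalSpan_mono hP hN) R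
  exact h hf

variable [Nontrivial k] [LinearOrder I]
  {br : L →ₗ[k] L →ₗ[k] L} {x : Module.Basis I k L} {I₀ : Set I}

variable (k I₀) in
/-- The span of the diwords `xₜ ⊣ x_{i₁} ⊣ ⋯ ⊣ x_{iₙ}` with `i₁ ≤ ⋯ ≤ iₙ` not in `I₀`. -/
noncomputable def rightIrr : Submodule k (FreeDialgebra k I) :=
  Submodule.span k {f | ∃ (t : I) (l : List I), l.Pairwise (· ≤ ·) ∧ (∀ i ∈ l, i ∉ I₀) ∧
    f = ofWord k ⟨[], t, l⟩}

variable (k I₀) in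
/-- The span of the diwords `x_{i₁} ⊢ ⋯ ⊢ x_{iₙ} ⊢ xₜ` with `i₁ ≤ ⋯ ≤ iₙ` not in `I₀`. -/
noncomputable def leftIrr : Submodule k (FreeDialgebra k I) :=
  Submodule.span k {f | ∃ (t : I) (l : List I), l.Pairwise (· ≤ ·) ∧ (∀ i ∈ l, i ∉ I₀) ∧
    f = ofWord k ⟨l, t, []⟩}

/-- The order on diwords need not be well founded, as `I` is only linearly ordered. The induction
therefore runs on length and inversions, while the bound in the diword order is carried along. -/
theorem right_reduction (t : I) (l : List I) : ofWord k ⟨[], t, l⟩ ∈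
    rightIrr k I₀ ⊔ normalSpan (pbwSet br x I₀) (· ≤ ⟨[], t, l⟩) IsRightNormed := by
  induction hμ : wordMeasure l using WellFoundedLT.induction generalizing l with
  | ind w ih =>
  subst hμ
  have hQ : ∀ l', wordMeasure l' < wordMeasure l → (⟨[], t, l'⟩ : Diword I) ≤ ⟨[], t, l⟩ →
      ofWord k ⟨[], t, l'⟩ ∈
        rightIrr k I₀ ⊔ normalSpan (pbwSet br x I₀) (· ≤ ⟨[], t, l⟩) IsRightNormed :=
    fun l' h h' => mem_sup_normalSpan_mono (fun _ hu => le_trans hu h') (fun _ h => h)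
      (ih _ h l' rfl)
  by_cases h₀ : ∃ i ∈ l, i ∈ I₀
  · obtain ⟨i, hi, hi₀⟩ := h₀
    obtain ⟨a, b, rfl⟩ := List.append_of_mem hi
    obtain ⟨c, t', hc, hcw⟩ := exists_right_context (k := k) t a b
    have hw : c.plugWord ⟨[], t', [i]⟩ = ⟨[], t, a ++ i :: b⟩ := by simp [hcw]
    have hs := hc _ (isRightNormed_ofWord t' [i])
    rw [← hw]
    refine ofWord_plugWord_mem (s := ofWord k ⟨[], t', [i]⟩) (Submodule.mem_sup_right
      (Submodule.subset_span ⟨_, Or.inr ⟨i, hi₀, t', (of_dashv_of t' i).symm⟩, _,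
        isLeading_ofWord _, c, hs.1, le_rfl, isRightNormed_ofWord t' [i], hs.2, rfl⟩)) ?_
    rw [sub_self, map_zero]
    exact zero_mem _
  by_cases hl : l.Pairwise (· ≤ ·)
  · exact Submodule.mem_sup_left (Submodule.subset_span
      ⟨t, l, hl, fun i hi hi₀ => h₀ ⟨i, hi, hi₀⟩, rfl⟩)
  · obtain ⟨a, b, i, j, hij, rfl⟩ := exists_descent hl
    obtain ⟨c, t', hc, hcw⟩ := exists_right_context (k := k) t a b
    have hw : ∀ l, c.plugLinear (ofWord k ⟨[], t', l⟩) = ofWord k ⟨[], t, a ++ l ++ b⟩ :=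
      fun l => by rw [DiContext.plugLinear_ofWord, hcw]
    have hw' : c.plugWord ⟨[], t', [j, i]⟩ = ⟨[], t, a ++ j :: i :: b⟩ := by simp [hcw]
    have hn := right_isRightNormed (x := x) (k := k) i j t' (br (x i) (x j))
    have hs := hc _ hn
    suffices h : ofWord k (c.plugWord ⟨[], t', [j, i]⟩) ∈ rightIrr k I₀
        ⊔ normalSpan (pbwSet br x I₀) (· ≤ ⟨[], t, a ++ j :: i :: b⟩) IsRightNormed by
      rwa [hw'] at h
    refine ofWord_plugWord_mem (Submodule.mem_sup_right
      (Submodule.subset_span ⟨_, Or.inl (Or.inr ⟨i, j, t', hij, rfl⟩), _,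
        (isLeading_of_sub_mem (right_sub_mem hij t')).1, c, hs.1, hw'.le, hn, hs.2, rfl⟩)) ?_
    rw [of_dashv_of_dashv_of, of_dashv_of_dashv_of, add_sub_right_comm, sub_sub_cancel_left,
      map_add, map_neg, hw]
    refine add_mem (neg_mem ?_) ?_
    · rw [List.append_assoc]
      exact hQ _ (wordMeasure_swap_lt a b hij) (Diword.swap_post_lt t a b hij).le
    · refine dashv_linearForm_mem c.plugLinear t' (fun m => ?_) _
      rw [hw, List.append_assoc]
      exact hQ _ (wordMeasure_lt_of_length_lt (by simp)) (Diword.lt_of_length_lt (by simp)).le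

theorem left_reduction (t : I) (l : List I) : ofWord k ⟨l, t, []⟩ ∈
    leftIrr k I₀ ⊔ normalSpan (pbwSet br x I₀) (· ≤ ⟨l, t, []⟩) IsLeftNormed := by
  induction hμ : wordMeasure l using WellFoundedLT.induction generalizing l with
  | ind w ih =>
  subst hμ
  have hQ : ∀ l', wordMeasure l' < wordMeasure l → (⟨l', t, []⟩ : Diword I) ≤ ⟨l, t, []⟩ →
      ofWord k ⟨l', t, []⟩ ∈
        leftIrr k I₀ ⊔ normalSpan (pbwSet br x I₀) (· ≤ ⟨l, t, []⟩) IsLeftNormed :=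
    fun l' h h' => mem_sup_normalSpan_mono (fun _ hu => le_trans hu h') (fun _ h => h)
      (ih _ h l' rfl)
  by_cases h₀ : ∃ i ∈ l, i ∈ I₀
  · obtain ⟨i, hi, hi₀⟩ := h₀
    obtain ⟨a, b, rfl⟩ := List.append_of_mem hi
    obtain ⟨c, t', hc, hcw⟩ := exists_left_context (k := k) t a b
    have hw : c.plugWord ⟨[i], t', []⟩ = ⟨a ++ i :: b, t, []⟩ := by simp [hcw]
    have hs := hc _ (isLeftNormed_ofWord [i] t')
    rw [← hw]
    refine ofWord_plugWord_mem (s := ofWord k ⟨[i], t', []⟩) (Submodule.mem_sup_right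
      (Submodule.subset_span ⟨_, Or.inl (Or.inl (Or.inr ⟨i, hi₀, t', (of_vdash_of i t').symm⟩)), _,
        isLeading_ofWord _, c, hs.1, le_rfl, isLeftNormed_ofWord [i] t', hs.2, rfl⟩)) ?_
    rw [sub_self, map_zero]
    exact zero_mem _
  by_cases hl : l.Pairwise (· ≤ ·)
  · exact Submodule.mem_sup_left (Submodule.subset_span
      ⟨t, l, hl, fun i hi hi₀ => h₀ ⟨i, hi, hi₀⟩, rfl⟩)
  · obtain ⟨a, b, i, j, hij, rfl⟩ := exists_descent hl
    obtain ⟨c, t', hc, hcw⟩ := exists_left_context (k := k) t a b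
    have hw : ∀ l, c.plugLinear (ofWord k ⟨l, t', []⟩) = ofWord k ⟨a ++ l ++ b, t, []⟩ :=
      fun l => by rw [DiContext.plugLinear_ofWord, hcw]
    have hw' : c.plugWord ⟨[j, i], t', []⟩ = ⟨a ++ j :: i :: b, t, []⟩ := by simp [hcw]
    have hn := left_isLeftNormed (x := x) (k := k) i j t' (br (x i) (x j))
    have hs := hc _ hn
    suffices h : ofWord k (c.plugWord ⟨[j, i], t', []⟩) ∈ leftIrr k I₀
        ⊔ normalSpan (pbwSet br x I₀) (· ≤ ⟨a ++ j :: i :: b, t, []⟩) IsLeftNormed by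
      rwa [hw'] at h
    refine ofWord_plugWord_mem (Submodule.mem_sup_right
      (Submodule.subset_span ⟨_, Or.inl (Or.inl (Or.inl (Or.inr ⟨i, j, t', hij, rfl⟩))), _,
        (isLeading_of_sub_mem (left_sub_mem hij t')).1, c, hs.1, hw'.le, hn, hs.2, rfl⟩)) ?_
    rw [of_vdash_of_vdash_of, of_vdash_of_vdash_of, add_sub_right_comm, sub_sub_cancel_left,
      map_add, map_neg, hw]
    refine add_mem (neg_mem ?_) ?_
    · rw [List.append_assoc]
      exact hQ _ (wordMeasure_swap_lt a b hij) (Diword.swap_pre_lt t a b hij).le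
    · refine linearForm_vdash_mem c.plugLinear t' (fun m => ?_) _
      rw [hw, List.append_assoc]
      exact hQ _ (wordMeasure_lt_of_length_lt (by simp)) (Diword.lt_of_length_lt (by simp)).le

/-- The first family moves the last letter before the center to just behind it, or absorbs it into
the center. Either way fewer letters precede the center, and `right_reduction` finishes. -/
theorem reduction (u : Diword I) : ofWord k u ∈
    rightIrr k I₀ ⊔ normalSpan (pbwSet br x I₀) (· ≤ u) (fun _ => True) := by
  induction hn : u.pre.length using Nat.strong_induction_on generalizing u with
  | _ n ih =>
  obtain ⟨a, i, b⟩ := u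
  have hQ : ∀ v : Diword I, v.pre.length < n → v ≤ ⟨a, i, b⟩ → ofWord k v ∈
      rightIrr k I₀ ⊔ normalSpan (pbwSet br x I₀) (· ≤ ⟨a, i, b⟩) (fun _ => True) :=
    fun v h h' => mem_sup_normalSpan_mono (fun _ hu => le_trans hu h') (fun _ h => h)
      (ih _ h v rfl)
  rcases List.eq_nil_or_concat a with rfl | ⟨a, j, rfl⟩
  · exact mem_sup_normalSpan_mono (fun _ h => h) (fun _ _ => trivial)
      (right_reduction i b)
  · simp only [List.concat_eq_append] at hn hQ ⊢
    have hw : ∀ a' b' t, (DiContext.center a b).plugLinear (ofWord k ⟨a', t, b'⟩)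
        = ofWord k ⟨a ++ a', t, b' ++ b⟩ := fun a' b' t => by simp [DiContext.plugWord]
    have hw' : (DiContext.center a b).plugWord ⟨[j], i, []⟩ = ⟨a ++ [j], i, b⟩ := by
      simp [DiContext.plugWord]
    suffices h : ofWord k ((DiContext.center a b).plugWord ⟨[j], i, []⟩) ∈ rightIrr k I₀
        ⊔ normalSpan (pbwSet br x I₀) (· ≤ ⟨a ++ [j], i, b⟩) (fun _ => True) by
      rwa [hw'] at h
    refine ofWord_plugWord_mem (Submodule.mem_sup_right
      (Submodule.subset_span ⟨_, Or.inl (Or.inl (Or.inl (Or.inl ⟨i, j, rfl⟩))), _,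
        (isLeading_of_sub_mem (mixed_sub_mem i j)).1, .center a b, trivial, hw'.le, trivial,
        trivial, rfl⟩)) ?_
    rw [of_dashv_of, of_vdash_of, add_sub_right_comm, sub_sub_cancel_left, map_add, map_neg, hw]
    simp only [List.length_append, List.length_singleton] at hn
    refine add_mem (neg_mem ?_) ?_
    · refine hQ _ (by simp; omega) ?_
      simpa using (Diword.move_center_lt a b i j).le
    · refine linearForm_mem (DiContext.center a b).plugLinear (fun m => ?_) _
      rw [of_eq_ofWord, hw]
      exact hQ _ (by simp; omega) (Diword.lt_of_length_lt (by simp)).le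

end Reduction

/-! ### Triviality of the compositions -/

section Compositions

open FreeDialgebra

variable {k L I : Type*} [CommRing k] [Nontrivial k] [AddCommGroup L] [Module k L] [LinearOrder I]
  {br : L →ₗ[k] L →ₗ[k] L} {x : Module.Basis I k L} {I₀ : Set I}

theorem mem_normalSpan_of_mem_diIdeal (hbr : IsLeibniz br)
    (hI₀ : Submodule.span k (x '' I₀) = leibnizKernel br) {P : Diword I → Prop}
    (hP : ∀ u v, u ≤ v → P v → P u) {f : FreeDialgebra k I}
    (hf : f ∈ diIdeal k (envelopingRelations br x)) (hfP : f ∈ wordSpan k P) :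
    f ∈ normalSpan (pbwSet br x I₀) P (fun _ => True) ∧
      (IsRightNormed f → f ∈ normalSpan (pbwSet br x I₀) P IsRightNormed) := by
  obtain ⟨T, hT, hfix⟩ := exists_projection hbr hI₀
  have hR : ∀ r ∈ rightIrr k I₀, T r = r := by
    refine fun r hr => (Submodule.span_le (p := LinearMap.eqLocus T LinearMap.id)).2 ?_ hr
    rintro _ ⟨t, l, hl, hl₀, rfl⟩
    exact hfix t l hl hl₀
  refine ⟨mem_of_mem_sup_of_projection T hR
    (fun m hm => hT m (normalSpan_le_diIdeal hI₀ _ _ hm)) (hT f hf) ?_, fun hn =>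
      mem_of_mem_sup_of_projection T hR
        (fun m hm => hT m (normalSpan_le_diIdeal hI₀ _ _ hm)) (hT f hf) ?_⟩
  · refine wordSpan_le (fun u hu => ?_) hfP
    exact mem_sup_normalSpan_mono (fun v hv => hP v u hv hu) (fun _ h => h)
      (reduction u)
  · have hfn : f ∈ wordSpan k (fun u => P u ∧ u.pre = []) :=
      mem_wordSpan.2 fun u hu => ⟨mem_wordSpan.1 hfP u hu, hn u hu⟩
    refine wordSpan_le ?_ hfn
    rintro ⟨_, t, l⟩ ⟨hu, rfl⟩
    exact mem_sup_normalSpan_mono (fun v hv => hP v _ hv hu) (fun _ h => h)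
      (right_reduction t l)

/-- A left normed element of `S` is `z ⊢ xₜ` with the associative word of `z` in `K`. It is not
right normed, so it never occurs after the center. -/
theorem preRepr_normalSpan_mem (hI₀ : Submodule.span k (x '' I₀) = leibnizKernel br)
    {P : Diword I → Prop} {f : FreeDialgebra k I}
    (hf : f ∈ normalSpan (pbwSet br x I₀) P IsLeftNormed) :
    preRepr x f ∈ tensorIdeal br x := by
  refine (Submodule.span_le (p := (tensorIdeal br x).comap (preRepr x))).2 ?_ hf
  rintro _ ⟨s, hs, u, -, c, hc, -, hn, -, rfl⟩
  obtain ⟨⟨z, t, rfl, hz⟩, hr⟩ := exists_of_isLeftNormed hI₀ hs hn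
  cases c with
  | center a b => exact preRepr_center_mem hz t a b
  | before a d =>
    refine preRepr_before_mem ?_ a d
    rw [toFreeAlgebra_vdash]
    exact mul_mem_commIdeal_right _ hz
  | after d b => exact absurd hc hr

/-- Ideal membership is replaced by vanishing under `preRepr`, because elements of the first family
need not vanish there. -/
theorem mem_left_normalSpan (hbr : IsLeibniz br)
    (hI₀ : Submodule.span k (x '' I₀) = leibnizKernel br) {P : Diword I → Prop}
    (hP : ∀ u v, u ≤ v → P v → P u) {f : FreeDialgebra k I}
    (hf : preRepr x f ∈ tensorIdeal br x) (hfP : f ∈ wordSpan k P) (hn : IsLeftNormed f) :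
    f ∈ normalSpan (pbwSet br x I₀) P IsLeftNormed := by
  obtain ⟨T, hT, hfix⟩ := exists_leftNormed_projection hbr hI₀
  have hR : ∀ r ∈ leftIrr k I₀, T r = r := by
    refine fun r hr => (Submodule.span_le (p := LinearMap.eqLocus T LinearMap.id)).2 ?_ hr
    rintro _ ⟨t, l, hl, hl₀, rfl⟩
    exact hfix t l hl hl₀
  refine mem_of_mem_sup_of_projection T hR
    (fun m hm => hT m (preRepr_normalSpan_mem hI₀ hm)) (hT f hf) ?_
  have hfn : f ∈ wordSpan k (fun u => P u ∧ u.post = []) :=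
    mem_wordSpan.2 fun u hu => ⟨mem_wordSpan.1 hfP u hu, hn u hu⟩
  refine wordSpan_le ?_ hfn
  rintro ⟨l, t, _⟩ ⟨hu, rfl⟩
  exact mem_sup_normalSpan_mono (fun v hv => hP v _ hv hu) (fun _ h => h)
    (left_reduction t l)

/-- No overlap is used: for any two normal `S`-diwords with the same leading diword, the difference
lies in the ideal and the monic leading terms cancel. -/
theorem isTrivialComposition_plug (hbr : IsLeibniz br)
    (hI₀ : Submodule.span k (x '' I₀) = leibnizKernel br) {f g : FreeDialgebra k I}
    (hf : f ∈ pbwSet br x I₀) (hg : g ∈ pbwSet br x I₀) {u v : Diword I} (hu : IsLeading f u)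
    (hv : IsLeading g v) {c d : DiContext I} (hc : c.IsNormal f) (hd : d.IsNormal g)
    (hw : c.plugWord u = d.plugWord v) :
    IsTrivialComposition (pbwSet br x I₀) (c.plugWord u) f (c.plug f) g (d.plug g) := by
  have hmem : c.plug f - d.plug g ∈ diIdeal k (envelopingRelations br x) :=
    sub_mem (plug_mem _ c (pbwSet_subset_diIdeal hI₀ hf))
      (plug_mem _ d (pbwSet_subset_diIdeal hI₀ hg))
  have hlt : c.plug f - d.plug g ∈ wordSpan k (· < c.plugWord u) := by
    have h1 := plug_sub_mem hu (pbwSet_leading_coeff hf hu) hc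
    have h2 := plug_sub_mem hv (pbwSet_leading_coeff hg hv) hd
    rw [← hw] at h2
    simpa using sub_mem h1 h2
  have hP : ∀ u' v', u' ≤ v' → v' < c.plugWord u → u' < c.plugWord u := fun _ _ h h' =>
    h.trans_lt h'
  obtain ⟨h1, h2⟩ := mem_normalSpan_of_mem_diIdeal hbr hI₀ hP hmem hlt
  refine ⟨h1, fun ⟨nf, np, ng, nq⟩ => ?_, fun ⟨_, np, _, nq⟩ => h2 ?_⟩
  · have hpre : ∀ s ∈ pbwSet br x I₀, IsLeftNormed s → ∀ e : DiContext I, e.IsNormal s →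
        IsLeftNormed (e.plug s) → preRepr x (e.plug s) ∈ tensorIdeal br x := by
      intro s hs ns e he ne
      obtain ⟨w, hw, -⟩ := pbwSet_exists_leading hs
      exact preRepr_normalSpan_mem hI₀ (P := fun _ => True)
        (Submodule.subset_span ⟨s, hs, w, hw, e, he, trivial, ns, ne, rfl⟩)
    refine mem_left_normalSpan hbr hI₀ hP ?_ hlt
      ((mem_wordSpan (P := fun u => u.post = [])).1
        (sub_mem (mem_wordSpan.2 np) (mem_wordSpan.2 nq)))
    rw [map_sub]
    exact sub_mem (hpre f hf nf c hc np) (hpre g hg ng d hd nq)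
  · exact (mem_wordSpan (P := fun u => u.pre = [])).1
      (sub_mem (mem_wordSpan.2 np) (mem_wordSpan.2 nq))

/-- The set `S` is a Gröbner–Shirshov basis. -/
theorem isGroebnerShirshovBasis_pbwSet (hbr : IsLeibniz br)
    (hI₀ : Submodule.span k (x '' I₀) = leibnizKernel br) :
    IsGroebnerShirshovBasis (pbwSet br x I₀) where
  monic _ hf := pbwSet_exists_leading hf
  left_mul f hf _ t :=
    (mem_normalSpan_of_mem_diIdeal hbr hI₀ (fun _ _ h h' => (Diword.length_le_of_le h).trans h')
      (IsDiIdeal.dashv_left (of k t) (pbwSet_subset_diIdeal hI₀ hf)) (mem_wordSpan_degree _)).2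
      (isRightNormed_of_dashv t f)
  right_mul f hf _ t := by
    refine mem_left_normalSpan hbr hI₀ (fun _ _ h h' => (Diword.length_le_of_le h).trans h') ?_
      (mem_wordSpan_degree _) (isLeftNormed_vdash_of f t)
    -- The polynomial `f` enters `f ⊢ xₜ` only through its associative word, which lies in `K`
    -- because `f` is in the ideal.
    exact preRepr_center_mem
      (toFreeAlgebra_mem (diRepr_mem hbr (pbwSet_subset_diIdeal hI₀ hf))) t [] []
  inclusion f hf g hg u v hu hv c hc hw := by
    -- An inclusion is the case where `f` stands in the empty context.
    have he : (DiContext.center [] []).plugWord u = u := by simp [DiContext.plugWord]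
    have := isTrivialComposition_plug hbr hI₀ hf hg hu hv (c := .center [] []) trivial hc
      (he.trans hw)
    rwa [he] at this
  intersection f hf g hg u v hu hv c d _ _ hc hd hw _ :=
    isTrivialComposition_plug hbr hI₀ hf hg hu hv hc hd hw

end Compositions

/-! ### The linear basis of the enveloping dialgebra -/

section EnvelopingBasis

open FreeDialgebra

variable {k L I : Type*} [CommRing k] [AddCommGroup L] [Module k L] [LinearOrder I]
  {br : L →ₗ[k] L →ₗ[k] L} {x : Module.Basis I k L} {I₀ : Set I}

/-- A linear section of the enveloping dialgebra over the irreducible diwords. -/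
theorem exists_enveloping_section (hbr : IsLeibniz br)
    (hI₀ : Submodule.span k (x '' I₀) = leibnizKernel br) :
    ∃ T : EnvelopingDialgebra br x →ₗ[k] FreeDialgebra k I,
      ∀ t l, l.Pairwise (· ≤ ·) → (∀ i ∈ l, i ∉ I₀) →
        T ((diIdeal k (envelopingRelations br x)).mkQ (ofWord k ⟨[], t, l⟩))
          = ofWord k ⟨[], t, l⟩ := by
  obtain ⟨T, hT, hfix⟩ := exists_projection hbr hI₀
  exact ⟨(diIdeal k (envelopingRelations br x)).liftQ T hT, hfix⟩

/-- Independence holds because the section returns distinct diwords; spanning holds because the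
`S`-part of `reduction` dies in the quotient. -/
theorem exists_pbw_basis [Nontrivial k] (hbr : IsLeibniz br)
    (hI₀ : Submodule.span k (x '' I₀) = leibnizKernel br) :
    ∃ b : Module.Basis (PBWIndex I₀) k (EnvelopingDialgebra br x), ∀ p : PBWIndex I₀,
      b p = (diIdeal k (envelopingRelations br x)).mkQ (dashvWord (of k p.1.1) p.1.2) := by
  obtain ⟨T, hT⟩ := exists_enveloping_section hbr hI₀
  set π := (diIdeal k (envelopingRelations br x)).mkQ with hπ
  have hli : LinearIndependent k fun p : PBWIndex I₀ => π (dashvWord (of k p.1.1) p.1.2) := by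
    refine LinearIndependent.of_comp T ?_
    have he : (T ∘ fun p : PBWIndex I₀ => π (dashvWord (of k p.1.1) p.1.2))
        = (fun u => Finsupp.single u 1) ∘
          fun p : PBWIndex I₀ => (⟨[], p.1.1, p.1.2⟩ : Diword I) := by
      funext p
      simp only [Function.comp_apply, dashvWord_of]
      exact hT _ _ p.2.1 p.2.2
    rw [he]
    refine (Finsupp.linearIndependent_single_one k (Diword I)).comp _ fun p q h => ?_
    simp only [Diword.mk.injEq, true_and] at h
    exact Subtype.ext (Prod.ext h.1 h.2)
  refine ⟨Module.Basis.mk hli ?_, fun p => Module.Basis.mk_apply _ _ p⟩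
  rintro q -
  obtain ⟨f, rfl⟩ := Submodule.mkQ_surjective _ q
  refine map_mem_of_ofWord π (fun u => ?_) f
  obtain ⟨r, hr, m, hm, hrm⟩ := Submodule.mem_sup.1 (reduction (br := br) (x := x) (I₀ := I₀) u)
  have hm0 : π m = 0 := (Submodule.Quotient.mk_eq_zero _).2 (normalSpan_le_diIdeal hI₀ _ _ hm)
  rw [← hrm, map_add, hm0, add_zero]
  refine (Submodule.span_le (p := (Submodule.span k (Set.range fun p : PBWIndex I₀ =>
    π (dashvWord (of k p.1.1) p.1.2))).comap π)).2 ?_ hr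
  rintro _ ⟨t, l, hl, hl₀, rfl⟩
  exact Submodule.subset_span ⟨⟨(t, l), hl, hl₀⟩, congrArg π (dashvWord_of t l)⟩

theorem toEnveloping_injective (hbr : IsLeibniz br)
    (hI₀ : Submodule.span k (x '' I₀) = leibnizKernel br) :
    Function.Injective (toEnveloping br x) := by
  obtain ⟨T, hT⟩ := exists_enveloping_section hbr hI₀
  -- Reading off the center of the one-letter diwords returned by the section gives a left inverse.
  have h : wordLift (fun u => x u.center) ∘ₗ T ∘ₗ toEnveloping br x = LinearMap.id := by
    refine x.ext fun i => ?_
    have hi := hT i [] List.Pairwise.nil (by simp)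
    rw [LinearMap.comp_apply, LinearMap.comp_apply, toEnveloping, LinearMap.comp_apply,
      linearForm_basis, of_eq_ofWord, hi, wordLift_ofWord, LinearMap.id_apply]
  exact Function.LeftInverse.injective (g := fun q => wordLift (fun u => x u.center) (T q))
    (LinearMap.congr_fun h)

end EnvelopingBasis

/-! ### The PBW theorem for Leibniz algebras. -/

theorem mainTheorem3 {k L I : Type*} [Field k] [AddCommGroup L] [Module k L] [LinearOrder I]
    (br : L →ₗ[k] L →ₗ[k] L) (hbr : IsLeibniz br)
    (x : Module.Basis I k L) (I₀ : Set I)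
    (hI₀ : Submodule.span k (x '' I₀) = leibnizKernel br) :
    FreeDialgebra.IsGroebnerShirshovBasis (pbwSet br x I₀) ∧
    diIdeal k (envelopingRelations br x) = diIdeal k (pbwSet br x I₀) ∧
    (∃ b : Module.Basis (PBWIndex I₀) k (EnvelopingDialgebra br x), ∀ p : PBWIndex I₀,
      b p = (diIdeal k (envelopingRelations br x)).mkQ
        (FreeDialgebra.dashvWord (FreeDialgebra.of k p.1.1) p.1.2)) ∧
    Function.Injective (toEnveloping br x) ∧
    ∀ a b : L, toEnveloping br x (br a b) =
      toEnveloping br x a ⊣ᵈ toEnveloping br x b - toEnveloping br x b ⊢ᵈ toEnveloping br x a :=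
  ⟨isGroebnerShirshovBasis_pbwSet hbr hI₀, diIdeal_pbwSet hI₀, exists_pbw_basis hbr hI₀,
    toEnveloping_injective hbr hI₀, toEnveloping_br⟩
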